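/- Let $m,n,k$ be non-negative integers with $k\le n$. An $(m,n,k)$-Gog trapezoid is an array of positive integers $m_{i,j}$, $1\le i\le n$, $1\le j\le\min(i,k)$, such that $m_{i+1,j}\le m_{i,j}\le m_{i+1,j+1}$ and $m_{i,j}<m_{i,j+1}$ whenever the entries in question exist, and $m_{i,j}\le m+n-i+j$ for all $i,j$. Its bottom row is $m_{n,1},\dots,m_{n,k}$. A minimum is an entry equal to $1$; a maximum is an entry $m_{i,k}$ (that is, an entry in the $k$-th north-east diagonal) with $m_{i,k}=m+n-i+k$. Let $P,Q$ be formal variables (or arbitrary elements of a commutative ring), and let rational functions in $x_1,\dots,x_n$ be expanded into Laurent series in powers of the $x_i$ with non-negative exponents, that is, $(1+Px_1)^{-1}=\sum_{j\ge0}(-P)^jx_1^j$. Let $b_1<b_2<\dots<b_k$ be positive integers with $b_j\le m+j$ for $1\le j\le k$. (1) If $k\ge1$ and $b_1=1$, then the generating function of $(m,n,k)$-Gog trapezoids with bottom row $1,b_2,\dots,b_k$ with respect to the weight $P^{\#\text{ of minima}}\,Q^{\#\text{ of maxima not including }b_k}$ is the constant term in $x_1,\dots,x_n$ of $$P(1+Px_1)^{-1}(1+x_1)^2x_1^{-n+1}\prod_{i=2}^{k}(1+x_i)^{b_i}x_i^{-n+1}\prod_{i=k+1}^{n}(1+Qx_i)(1+x_i)^{m+k}x_i^{-n+i-k}\prod_{1\le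 i<j\le n}(x_i-x_j)(1+x_j+x_ix_j).$$ (2) The generating function of $(m,n,k)$-Gog trapezoids with bottom row $b_1,b_2,\dots,b_k$ with respect to the weight $Q^{\#\text{ of maxima not including }b_k}$ is the constant term in $x_1,\dots,x_n$ of $$\prod_{i=1}^{k}(1+x_i)^{b_i}x_i^{-n+1}\prod_{i=k+1}^{n}(1+Qx_i)(1+x_i)^{m+k}x_i^{-n+i-k}\prod_{1\le i<j\le n}(x_i-x_j)(1+x_j+x_ix_j).$$ (3) If $k\ge1$, then the generating function of all $(0,n,k)$-Gog trapezoids with respect to the weight $P^{\#\text{ of minima}}\,Q^{\#\text{ of maxima}}$ is the constant term in $x_1,\dots,x_n$ of $$PQ(1+Px_1)^{-1}(1+x_1)^2x_1^{-n+1}\prod_{i=2}^{k}(1+x_i)^{i}x_i^{-n+1}\prod_{i=k+1}^{n}(1+Qx_i)(1+x_i)^{k}x_i^{-n+i-k}\prod_{1\le i<j\le n}(x_i-x_j)(1+x_j+x_ix_j).$$ -/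

import Mathlib

noncomputable section

namespace Gog

/-! ### Gog trapezoids

The entry `m_{i,j}` stands in the `i`-th row from the top and in the `j`-th north-east diagonal from
the left. Its south-west and south-east neighbours are `m_{i+1,j}` and `m_{i+1,j+1}`. -/

/-- The positions of an `(m,n,k)`-Gog trapezoid: `n` rows, `k` north-east diagonals, and row `i`
has `min i k` entries. -/
def shape (n k : ℕ) : Finset (ℕ × ℕ) :=
  (Finset.Icc 1 n ×ˢ Finset.Icc 1 k).filter fun p => p.2 ≤ p.1

/-- The upper bound `m + l` for position `(i,j)`, where `l = n - i + j` is the number, counted from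
the left, of the south-east diagonal through `(i,j)` (its bottom entry would be `m_{n,l}`). -/
def bound (m n i j : ℕ) : ℕ := m + (n - i + j)

/-- An `(m,n,k)`-Gog trapezoid. Outside the shape the entries are set to `0`, so that two trapezoids
are equal exactly when they agree on the shape. -/
@[ext]
structure Trapezoid (m n k : ℕ) where
  entry : ℕ → ℕ → ℕ
  entry_outside : ∀ i j, (i, j) ∉ shape n k → entry i j = 0
  entry_pos : ∀ i j, (i, j) ∈ shape n k → 1 ≤ entry i j
  entry_le : ∀ i j, (i, j) ∈ shape n k → entry i j ≤ bound m n i j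
  northEast : ∀ i j, (i, j) ∈ shape n k → (i + 1, j) ∈ shape n k →
    entry (i + 1) j ≤ entry i j
  southEast : ∀ i j, (i, j) ∈ shape n k → (i + 1, j + 1) ∈ shape n k →
    entry i j ≤ entry (i + 1) (j + 1)
  row_strict : ∀ i j, (i, j) ∈ shape n k → (i, j + 1) ∈ shape n k →
    entry i j < entry i (j + 1)

instance (m n k : ℕ) : Finite (Trapezoid m n k) := by
  let F : Trapezoid m n k → (shape n k → Fin (m + n + 1)) := fun M p =>
    ⟨M.entry p.1.1 p.1.2, by
      have h := M.entry_le p.1.1 p.1.2 p.2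
      have hp := p.2
      simp only [shape, Finset.mem_filter, Finset.mem_product, Finset.mem_Icc] at hp
      unfold bound at h
      omega⟩
  refine Finite.of_injective F fun M N h => ?_
  ext i j
  by_cases hp : (i, j) ∈ shape n k
  · have := congrArg Fin.val (congrFun h ⟨(i, j), hp⟩)
    exact this
  · rw [M.entry_outside i j hp, N.entry_outside i j hp]

instance (m n k : ℕ) : Fintype (Trapezoid m n k) := Fintype.ofFinite _

namespace Trapezoid

variable {m n k : ℕ}

/-- `M` has bottom row `b 1, …, b k`. -/
def HasBottomRow (M : Trapezoid m n k) (b : ℕ → ℕ) : Prop :=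
  ∀ j ∈ Finset.Icc 1 k, M.entry n j = b j

/-- The number of minima, that is, of entries equal to `1`. -/
def numMinima (M : Trapezoid m n k) : ℕ :=
  ((shape n k).filter fun p => M.entry p.1 p.2 = 1).card

/-- The maxima: the entries in the `k`-th north-east diagonal that are equal to the upper bound for
their south-east diagonal. -/
def maxima (M : Trapezoid m n k) : Finset (ℕ × ℕ) :=
  (shape n k).filter fun p => p.2 = k ∧ M.entry p.1 p.2 = bound m n p.1 p.2

/-- The number of all maxima. -/
def numMaxima (M : Trapezoid m n k) : ℕ := M.maxima.card

/-- The number of maxima, where the entry `m_{n,k} = b_k` is not counted. -/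
def numMaxima' (M : Trapezoid m n k) : ℕ := (M.maxima.erase (n, k)).card

end Trapezoid

/-- `b 1 < … < b k` are positive integers with `b j ≤ m + j`: what a bottom row of an
`(m,n,k)`-Gog trapezoid has to satisfy. -/
def IsBottomRow (m k : ℕ) (b : ℕ → ℕ) : Prop :=
  StrictMonoOn b (Set.Icc 1 k) ∧ ∀ j ∈ Finset.Icc 1 k, 1 ≤ b j ∧ b j ≤ m + j

/-! ### Laurent series and constant terms -/

/-- Formal Laurent series in the variables `x_1, x_2, …` over `R`, expanded in powers with
non-negative exponents (Hahn series for the componentwise order on exponent vectors). The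
expressions below involve only `x_1, …, x_n`. -/
abbrev Laurent (R : Type*) [CommRing R] := HahnSeries (ℕ →₀ ℤ) R

variable {R : Type*} [CommRing R]

/-- The monomial `x_i ^ a`, for an integer `a`. -/
def xpow (i : ℕ) (a : ℤ) : Laurent R := HahnSeries.single (Finsupp.single i a) 1

/-- The variable `x_i`. -/
def x (i : ℕ) : Laurent R := xpow i 1

/-- The scalar `c`, as a constant Laurent series. -/
def const (c : R) : Laurent R := HahnSeries.C c

/-- The constant term: the coefficient of the monomial with all exponents `0`. -/
def constantTerm (f : Laurent R) : R := f.coeff 0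

/-- `1 + c x_i` is invertible, so that `Ring.inverse` in the definitions below is its inverse. -/
theorem isUnit_one_add (c : R) (i : ℕ) : IsUnit (1 + const c * x i : Laurent R) := by
  let g : ℕ →+ (ℕ →₀ ℤ) :=
    (Finsupp.singleAddHom i).comp (Nat.castAddMonoidHom ℤ)
  have hg : ∀ a b : ℕ, g a ≤ g b ↔ a ≤ b := by
    intro a b
    simp [g, Finsupp.single_le_single]
  have hinj : Function.Injective g := fun a b h =>
    le_antisymm ((hg a b).1 h.le) ((hg b a).1 h.ge)
  let φ : PowerSeries R →+* Laurent R :=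
    (HahnSeries.embDomainRingHom g hinj hg).comp
      (RingEquiv.toRingHom HahnSeries.toPowerSeries.symm)
  have hu : IsUnit (1 + PowerSeries.C c * PowerSeries.X : PowerSeries R) := by
    rw [PowerSeries.isUnit_iff_constantCoeff]
    simp
  have hC : HahnSeries.toPowerSeries.symm (PowerSeries.C c) = (HahnSeries.C c : HahnSeries ℕ R) := by
    rw [RingEquiv.symm_apply_eq]
    ext t
    rw [HahnSeries.coeff_toPowerSeries, PowerSeries.coeff_C, HahnSeries.C_apply]
    by_cases ht : t = 0
    · subst ht; simp
    · simp [ht, HahnSeries.coeff_single_of_ne]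
  have hX : HahnSeries.toPowerSeries.symm (PowerSeries.X : PowerSeries R)
      = (HahnSeries.single 1 1 : HahnSeries ℕ R) := by
    rw [RingEquiv.symm_apply_eq]
    ext t
    rw [HahnSeries.coeff_toPowerSeries, PowerSeries.coeff_X]
    by_cases ht : t = 1
    · subst ht; simp
    · simp [ht, HahnSeries.coeff_single_of_ne]
  have hφ : φ (1 + PowerSeries.C c * PowerSeries.X) = 1 + const c * x i := by
    rw [map_add, map_one, map_mul]
    congr 2
    · change HahnSeries.embDomainRingHom g hinj hg (HahnSeries.toPowerSeries.symm _) = _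
      rw [hC, HahnSeries.embDomainRingHom_C]; rfl
    · change HahnSeries.embDomain _ (HahnSeries.toPowerSeries.symm _) = _
      rw [hX, HahnSeries.embDomain_single]
      simp [x, xpow, g]
  rw [← hφ]
  exact hu.map φ

/-- `∏_{1 ≤ i < j ≤ n} (x_i - x_j) (1 + x_j + x_i x_j)` -/
def pairProduct (R : Type*) [CommRing R] (n : ℕ) : Laurent R :=
  ∏ i ∈ Finset.Icc 1 n, ∏ j ∈ Finset.Ioc i n, (x i - x j) * (1 + x j + x i * x j)

/-- `∏_{i=k+1}^{n} (1 + Q x_i) (1 + x_i)^{m+k} x_i^{-n+i-k}` -/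
def maximaProduct (m n k : ℕ) (Q : R) : Laurent R :=
  ∏ i ∈ Finset.Icc (k + 1) n,
    (1 + const Q * x i) * (1 + x i) ^ (m + k) * xpow i (-(n : ℤ) + i - k)

/-- `P (1 + P x_1)^{-1} (1 + x_1)^2 x_1^{-n+1} ∏_{i=2}^{k} (1 + x_i)^{b_i} x_i^{-n+1}`
`× ∏_{i=k+1}^{n} (1 + Q x_i) (1 + x_i)^{m+k} x_i^{-n+i-k}`
`× ∏_{1 ≤ i < j ≤ n} (x_i - x_j) (1 + x_j + x_i x_j)` -/
def minMaxIntegrand (m n k : ℕ) (b : ℕ → ℕ) (P Q : R) : Laurent R :=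
  const P * Ring.inverse (1 + const P * x 1) * (1 + x 1) ^ 2 * xpow 1 (-(n : ℤ) + 1)
    * (∏ i ∈ Finset.Icc 2 k, (1 + x i) ^ b i * xpow i (-(n : ℤ) + 1))
    * maximaProduct m n k Q * pairProduct R n

/-- `∏_{i=1}^{k} (1 + x_i)^{b_i} x_i^{-n+1}`
`× ∏_{i=k+1}^{n} (1 + Q x_i) (1 + x_i)^{m+k} x_i^{-n+i-k}`
`× ∏_{1 ≤ i < j ≤ n} (x_i - x_j) (1 + x_j + x_i x_j)` -/
def maxIntegrand (m n k : ℕ) (b : ℕ → ℕ) (Q : R) : Laurent R :=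
  (∏ i ∈ Finset.Icc 1 k, (1 + x i) ^ b i * xpow i (-(n : ℤ) + 1))
    * maximaProduct m n k Q * pairProduct R n

end Gog

end

/-! Both sides obey the same recursion under removal of the bottom row. `pairing n f` is the
constant term of the product of all f_i(x_i) x_i^{-n+1} with the pair product; it is multilinear in
the f_i. An entry b is encoded by (1+X)^b, and (1+X)^b = ∑_{a=b}^{c} (-X)(1+X)^a + (1+X)^{c+1} turns
it into a sum over the entries a above it.

Take c to be the right neighbour of b. The remainder and the series of that neighbour then have the
form ((1+X)h, h), which `pairing_exchange` replaces by minus (-Xh, -Xh). This subtracts the rows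
whose entries in these two positions both equal c, the only way in which interlacing rows can fail
to increase strictly. When all positions but one carry a factor X, `pairing_extract` eliminates the
remaining variable. The later series move down one position and gain a factor 1+X, so that (m,n,k)
becomes (m+1,n-1,k).

Minima: F = P(1+PX)^{-1}(1+X)^2 solves F = P(-XF + (1+X)^2), so an entry 1 yields a factor P and may
have another 1 above it. Maxima: the last entry stands next to (1+QX)(1+X)^t = Q(1+X)^{t+1} +
(1-Q)(1+X)^t with t = m+k. Its remainder (1+X)^{t+1} pairs to zero with the second summand, and with
the first it gives the maximal entry t+1 with weight Q.

Part (2) is the case P = 1, where F = 1+X. In part (3), m = 0 forces the bottom row 1, …, k. -/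

noncomputable section

namespace Gog

variable {R : Type*} [CommRing R]

/-! ### Laurent series: one-variable series, monomials, renaming of variables -/

/-- The embedding `f(X) ↦ f(x_i)` of univariate power series. -/
def inVar (i : ℕ) : PowerSeries R →+* Laurent R :=
  (HahnSeries.embDomainRingHom ((Finsupp.singleAddHom i).comp (Nat.castAddMonoidHom ℤ))
    (fun a b h => by simpa using Finsupp.single_injective i h)
    (fun a b => by simp [Finsupp.single_le_single])).comp
      (RingEquiv.toRingHom HahnSeries.toPowerSeries.symm)

theorem coeff_inVar_single (i : ℕ) (f : PowerSeries R) (a : ℕ) :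
    (inVar i f).coeff (Finsupp.single i (a : ℤ)) = PowerSeries.coeff a f :=
  HahnSeries.embDomain_coeff (a := a)

theorem coeff_inVar_eq_zero (i : ℕ) (f : PowerSeries R) (e : ℕ →₀ ℤ)
    (he : ∀ a : ℕ, e ≠ Finsupp.single i (a : ℤ)) : (inVar i f).coeff e = 0 := by
  refine HahnSeries.embDomain_of_notMem_range ?_
  rintro ⟨a, rfl⟩
  exact he a rfl

theorem inVar_X (i : ℕ) : inVar i (PowerSeries.X : PowerSeries R) = x i := by
  ext e
  by_cases he : ∃ a : ℕ, e = Finsupp.single i (a : ℤ)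
  · obtain ⟨a, rfl⟩ := he
    rw [coeff_inVar_single, PowerSeries.coeff_X, x, xpow, HahnSeries.coeff_single]
    simp [(Finsupp.single_injective i).eq_iff]
  · push Not at he
    rw [coeff_inVar_eq_zero i _ e he, x, xpow, HahnSeries.coeff_single_of_ne]
    simpa using he 1

theorem inVar_C (i : ℕ) (c : R) : inVar i (PowerSeries.C c) = const c := by
  ext e
  rw [const, HahnSeries.C_apply]
  by_cases he : ∃ a : ℕ, e = Finsupp.single i (a : ℤ)
  · obtain ⟨a, rfl⟩ := he
    rw [coeff_inVar_single, PowerSeries.coeff_C, HahnSeries.coeff_single]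
    simp
  · push Not at he
    rw [coeff_inVar_eq_zero i _ e he, HahnSeries.coeff_single_of_ne]
    simpa using he 0

theorem xpow_mul_xpow (i : ℕ) (a b : ℤ) : (xpow i a * xpow i b : Laurent R) = xpow i (a + b) := by
  simp [xpow, HahnSeries.single_mul_single, Finsupp.single_add]

theorem xpow_zero (i : ℕ) : (xpow i 0 : Laurent R) = 1 := by
  simp [xpow]

theorem x_pow (i a : ℕ) : (x i ^ a : Laurent R) = xpow i a := by
  simp [x, xpow, HahnSeries.single_pow]

/-- Renaming of the variables along an injective map. -/
def ren (σ : ℕ → ℕ) (hσ : Function.Injective σ) : Laurent R →+* Laurent R :=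
  HahnSeries.embDomainRingHom (Finsupp.mapDomain.addMonoidHom σ)
    (Finsupp.mapDomain_injective hσ)
    (fun a b => Finsupp.mapDomain_le_mapDomain_iff_le hσ a b)

variable {σ : ℕ → ℕ} (hσ : Function.Injective σ)

theorem constantTerm_ren (f : Laurent R) : constantTerm (ren σ hσ f) = constantTerm f := by
  have h : (ren σ hσ f).coeff (Finsupp.mapDomain σ 0) = f.coeff 0 :=
    HahnSeries.embDomain_coeff (a := (0 : ℕ →₀ ℤ))
  simpa [constantTerm] using h

theorem ren_xpow (i : ℕ) (a : ℤ) : ren σ hσ (xpow i a : Laurent R) = xpow (σ i) a := by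
  change HahnSeries.embDomain _ (HahnSeries.single _ _) = _
  rw [HahnSeries.embDomain_single]
  change HahnSeries.single (Finsupp.mapDomain σ _) _ = _
  rw [Finsupp.mapDomain_single, xpow]

theorem ren_x (i : ℕ) : ren σ hσ (x i : Laurent R) = x (σ i) := ren_xpow hσ i 1

theorem ren_inVar (i : ℕ) (f : PowerSeries R) : ren σ hσ (inVar i f) = inVar (σ i) f := by
  ext e
  by_cases he : ∃ d, e = Finsupp.mapDomain σ d
  · obtain ⟨d, rfl⟩ := he
    have h : (ren σ hσ (inVar i f)).coeff (Finsupp.mapDomain σ d) = (inVar i f).coeff d :=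
      HahnSeries.embDomain_coeff (a := d)
    rw [h]
    by_cases hd : ∃ a : ℕ, d = Finsupp.single i (a : ℤ)
    · obtain ⟨a, rfl⟩ := hd
      rw [coeff_inVar_single, Finsupp.mapDomain_single, coeff_inVar_single]
    · push Not at hd
      rw [coeff_inVar_eq_zero _ _ _ hd, coeff_inVar_eq_zero]
      intro a ha
      rw [← Finsupp.mapDomain_single] at ha
      exact hd a (Finsupp.mapDomain_injective hσ ha)
  · push Not at he
    have h : (ren σ hσ (inVar i f)).coeff e = 0 := by
      refine HahnSeries.embDomain_of_notMem_range ?_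
      rintro ⟨d, rfl⟩
      exact he d rfl
    rw [h, coeff_inVar_eq_zero]
    intro a ha
    exact he (Finsupp.single i (a : ℤ)) (by rw [ha, Finsupp.mapDomain_single])

theorem constantTerm_add (f g : Laurent R) :
    constantTerm (f + g) = constantTerm f + constantTerm g := rfl

theorem constantTerm_sub (f g : Laurent R) :
    constantTerm (f - g) = constantTerm f - constantTerm g := rfl

theorem constantTerm_const_mul (c : R) (f : Laurent R) :
    constantTerm (const c * f) = c * constantTerm f := by
  rw [const, HahnSeries.C_mul_eq_smul]
  rfl

theorem constantTerm_one : constantTerm (1 : Laurent R) = 1 := by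
  simp [constantTerm]

/-! ### Setting a variable to zero under the constant term -/

/-- The Laurent series without negative powers of `x_p`. -/
def nonnegIn (R : Type*) [CommRing R] (p : ℕ) : Subring (Laurent R) where
  carrier := {f | ∀ e, f.coeff e ≠ 0 → 0 ≤ e p}
  mul_mem' {f g} hf hg e he := by
    rw [HahnSeries.coeff_mul] at he
    obtain ⟨⟨a, b⟩, hab, -⟩ := Finset.exists_ne_zero_of_sum_ne_zero he
    rw [Finset.mem_antidiagonal] at hab
    obtain ⟨ha, hb, rfl⟩ := hab
    exact add_nonneg (hf a ha) (hg b hb)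
  one_mem' e he := by
    by_contra h
    apply he
    rw [HahnSeries.coeff_one, if_neg]
    rintro rfl
    simp at h
  add_mem' {f g} hf hg e he := by
    by_contra h
    apply he
    have h1 : f.coeff e = 0 := by
      by_contra h'
      exact h (hf e h')
    have h2 : g.coeff e = 0 := by
      by_contra h'
      exact h (hg e h')
    rw [HahnSeries.coeff_add, h1, h2, add_zero]
  zero_mem' e he := by simp at he
  neg_mem' {f} hf e he := hf e (by simpa using he)

theorem inVar_mem_nonnegIn (p i : ℕ) (f : PowerSeries R) : inVar i f ∈ nonnegIn R p := by
  intro e he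
  by_contra h
  apply he
  apply coeff_inVar_eq_zero
  rintro a rfl
  apply h
  rw [Finsupp.single_apply]
  split_ifs <;> simp

theorem x_mem_nonnegIn (p i : ℕ) : (x i : Laurent R) ∈ nonnegIn R p :=
  inVar_X (R := R) i ▸ inVar_mem_nonnegIn p i _

theorem xpow_mem_nonnegIn {p i : ℕ} (h : i ≠ p) (a : ℤ) :
    (xpow i a : Laurent R) ∈ nonnegIn R p := by
  intro e he
  by_contra h'
  apply he
  apply HahnSeries.coeff_single_of_ne
  rintro rfl
  apply h'
  rw [Finsupp.single_eq_of_ne h.symm]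

theorem constantTerm_x_mul {p : ℕ} {f : Laurent R} (hf : f ∈ nonnegIn R p) :
    constantTerm (x p * f) = 0 := by
  rw [constantTerm, x, xpow, HahnSeries.coeff_single_mul, one_mul]
  by_contra h
  have := hf _ h
  simp at this

/-- Congruence modulo `x_p` of Laurent series without negative powers of `x_p`. -/
def CongrIn (p : ℕ) (f g : Laurent R) : Prop :=
  f ∈ nonnegIn R p ∧ g ∈ nonnegIn R p ∧ ∃ h ∈ nonnegIn R p, f = g + x p * h

namespace CongrIn

variable {p : ℕ} {f g f' g' : Laurent R}

theorem refl (hf : f ∈ nonnegIn R p) : CongrIn p f f :=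
  ⟨hf, hf, 0, zero_mem _, by simp⟩

theorem of_eq {h : Laurent R} (hg : g ∈ nonnegIn R p) (hh : h ∈ nonnegIn R p)
    (e : f = g + x p * h) : CongrIn p f g :=
  ⟨e ▸ add_mem hg (mul_mem (x_mem_nonnegIn p p) hh), hg, h, hh, e⟩

theorem mul (h : CongrIn p f g) (h' : CongrIn p f' g') : CongrIn p (f * f') (g * g') := by
  obtain ⟨hf, hg, a, ha, e⟩ := h
  obtain ⟨hf', hg', b, hb, e'⟩ := h'
  refine ⟨mul_mem hf hf', mul_mem hg hg', a * f' + g * b,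
    add_mem (mul_mem ha hf') (mul_mem hg hb), ?_⟩
  rw [e, e']
  ring

theorem prod {ι : Type*} (s : Finset ι) (F G : ι → Laurent R)
    (h : ∀ i ∈ s, CongrIn p (F i) (G i)) : CongrIn p (∏ i ∈ s, F i) (∏ i ∈ s, G i) := by
  classical
  induction s using Finset.induction_on with
  | empty => simpa using refl (one_mem _)
  | insert a s ha ih =>
    rw [Finset.prod_insert ha, Finset.prod_insert ha]
    exact (h a (by simp)).mul (ih fun i hi => h i (by simp [hi]))

theorem constantTerm_eq (h : CongrIn p f g) : constantTerm f = constantTerm g := by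
  obtain ⟨-, -, a, ha, rfl⟩ := h
  rw [constantTerm_add, constantTerm_x_mul ha, add_zero]

end CongrIn

/-- With `CongrIn.constantTerm_eq`, this amounts to putting x_p = 0 in a factor under the constant
term. -/
theorem congrIn_inVar (p : ℕ) (f : PowerSeries R) :
    CongrIn p (inVar p f) (const (PowerSeries.constantCoeff f)) := by
  obtain ⟨g, hg⟩ : (PowerSeries.X : PowerSeries R) ∣ f - PowerSeries.C (PowerSeries.constantCoeff f) := by
    rw [PowerSeries.X_dvd_iff]
    simp
  refine CongrIn.of_eq (h := inVar p g) ?_ (inVar_mem_nonnegIn _ _ _) ?_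
  · rw [← inVar_C p]
    exact inVar_mem_nonnegIn _ _ _
  · rw [← inVar_X, ← map_mul, ← hg, ← inVar_C p, ← map_add]
    simp

/-! ### The pairing and its multilinearity -/

/-- The coefficient of `∏_i x_i ^ (n-1)` in
`∏_i f_i(x_i) ∏_{i<j} (x_i - x_j) (1 + x_j + x_i x_j)`. -/
def pairing (n : ℕ) (f : ℕ → PowerSeries R) : R :=
  constantTerm ((∏ i ∈ Finset.Icc 1 n, inVar i (f i) * xpow i (-(n : ℤ) + 1)) * pairProduct R n)

theorem pairing_congr {n : ℕ} {f g : ℕ → PowerSeries R} (h : ∀ i ∈ Finset.Icc 1 n, f i = g i) :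
    pairing n f = pairing n g := by
  unfold pairing
  rw [Finset.prod_congr rfl fun i hi => by rw [h i hi]]

theorem pairing_zero (f : ℕ → PowerSeries R) : pairing 0 f = 1 := by
  simp [pairing, pairProduct, constantTerm_one]

theorem prod_erase_eq {n i : ℕ} {f g : ℕ → PowerSeries R}
    (h : ∀ l ∈ Finset.Icc 1 n, l ≠ i → g l = f l) :
    ∏ l ∈ (Finset.Icc 1 n).erase i, inVar l (g l) * (xpow l (-(n : ℤ) + 1) : Laurent R)
      = ∏ l ∈ (Finset.Icc 1 n).erase i, inVar l (f l) * xpow l (-(n : ℤ) + 1) :=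
  Finset.prod_congr rfl fun l hl => by
    rw [h l (Finset.mem_of_mem_erase hl) (Finset.ne_of_mem_erase hl)]

theorem pairing_add {n i : ℕ} (hi : i ∈ Finset.Icc 1 n) {f g h : ℕ → PowerSeries R}
    (hf : f i = g i + h i) (hg : ∀ l ∈ Finset.Icc 1 n, l ≠ i → g l = f l)
    (hh : ∀ l ∈ Finset.Icc 1 n, l ≠ i → h l = f l) :
    pairing n f = pairing n g + pairing n h := by
  unfold pairing
  rw [← constantTerm_add, ← Finset.mul_prod_erase _ _ hi, ← Finset.mul_prod_erase _ _ hi,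
    ← Finset.mul_prod_erase _ _ hi, hf, map_add]
  rw [prod_erase_eq hg, prod_erase_eq hh]
  congr 1
  ring

theorem pairing_smul {n i : ℕ} (hi : i ∈ Finset.Icc 1 n) (c : R) {f g : ℕ → PowerSeries R}
    (hf : f i = PowerSeries.C c * g i) (hg : ∀ l ∈ Finset.Icc 1 n, l ≠ i → g l = f l) :
    pairing n f = c * pairing n g := by
  unfold pairing
  rw [← constantTerm_const_mul, ← Finset.mul_prod_erase _ _ hi, ← Finset.mul_prod_erase _ _ hi,
    hf, map_mul, inVar_C]
  rw [prod_erase_eq hg]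
  congr 1
  ring

theorem pairing_sum {n i : ℕ} (hi : i ∈ Finset.Icc 1 n) {ι : Type*} (s : Finset ι)
    (φ : ι → PowerSeries R) (f : ℕ → PowerSeries R) :
    pairing n (Function.update f i (∑ a ∈ s, φ a))
      = ∑ a ∈ s, pairing n (Function.update f i (φ a)) := by
  classical
  induction s using Finset.induction_on with
  | empty =>
    rw [pairing_smul (c := 0) (g := Function.update f i 0) hi] <;> simp
  | insert a s ha ih =>
    rw [Finset.sum_insert ha, Finset.sum_insert ha, ← ih]
    apply pairing_add hi
    · simp
    · intro l _ hl
      simp [hl]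
    · intro l _ hl
      simp [hl]

/-! ### Antisymmetry in adjacent variables -/

theorem pairProduct_eq_prod_pairs (n : ℕ) : pairProduct R n =
    ∏ q ∈ (Finset.Icc 1 n ×ˢ Finset.Icc 1 n).filter (fun q => q.1 < q.2),
      (x q.1 - x q.2) * (1 + x q.2 + x q.1 * x q.2) := by
  rw [pairProduct, Finset.prod_filter, Finset.prod_product]
  refine Finset.prod_congr rfl fun i hi => ?_
  rw [← Finset.prod_filter]
  refine Finset.prod_congr ?_ fun _ _ => rfl
  ext j
  simp only [Finset.mem_Icc, Finset.mem_Ioc, Finset.mem_filter] at *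
  omega

/-- Renaming does not change the constant term, so x_i S and x_j S have the same one. -/
theorem constantTerm_sub_mul_eq_zero {i j : ℕ} {S : Laurent R}
    (hS : ren (Equiv.swap i j) (Equiv.injective _) S = S) :
    constantTerm ((x i - x j) * S) = 0 := by
  have h := constantTerm_ren (Equiv.injective (Equiv.swap i j)) (x i * S)
  rw [map_mul, ren_x, hS, Equiv.swap_apply_left] at h
  rw [sub_mul, constantTerm_sub, h, sub_self]

/-- The symmetry behind the vanishing of antisymmetric expressions. -/
theorem pairing_swap {n i : ℕ} (hi : 1 ≤ i) (hin : i + 1 ≤ n) {f g : ℕ → PowerSeries R}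
    {h : PowerSeries R} (hf : f i = h) (hf' : f (i + 1) = h) (hg : g i = -PowerSeries.X * h)
    (hg' : g (i + 1) = (1 + PowerSeries.X) * h)
    (hfg : ∀ l ∈ Finset.Icc 1 n, l ≠ i → l ≠ i + 1 → g l = f l) :
    pairing n f = pairing n g := by
  have h1 : i ∈ Finset.Icc 1 n := Finset.mem_Icc.2 ⟨hi, by omega⟩
  have h2 : i + 1 ∈ (Finset.Icc 1 n).erase i :=
    Finset.mem_erase.2 ⟨by omega, Finset.mem_Icc.2 ⟨by omega, hin⟩⟩
  have h3 : (i, i + 1) ∈ (Finset.Icc 1 n ×ˢ Finset.Icc 1 n).filter (fun q => q.1 < q.2) := by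
    simp only [Finset.mem_filter, Finset.mem_product, Finset.mem_Icc]
    omega
  unfold pairing
  rw [pairProduct_eq_prod_pairs, ← Finset.mul_prod_erase _ _ h3,
    ← Finset.mul_prod_erase _ _ h1, ← Finset.mul_prod_erase _ _ h2,
    ← Finset.mul_prod_erase _ _ h1, ← Finset.mul_prod_erase _ _ h2,
    hf, hf', hg, hg']
  rw [show ∏ l ∈ ((Finset.Icc 1 n).erase i).erase (i + 1), inVar l (g l) * xpow l (-(n : ℤ) + 1)
      = ∏ l ∈ ((Finset.Icc 1 n).erase i).erase (i + 1), inVar l (f l) * xpow l (-(n : ℤ) + 1) from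
    Finset.prod_congr rfl fun l hl => by
      simp only [Finset.mem_erase] at hl
      rw [hfg l hl.2.2 hl.2.1 hl.1]]
  rw [← sub_eq_zero, ← constantTerm_sub]
  simp only [map_mul, map_add, map_one, map_neg, inVar_X]
  set A := ∏ l ∈ ((Finset.Icc 1 n).erase i).erase (i + 1),
    inVar l (f l) * xpow l (-(n : ℤ) + 1) with hA
  set B := ∏ q ∈ ((Finset.Icc 1 n ×ˢ Finset.Icc 1 n).filter (fun q => q.1 < q.2)).erase (i, i + 1),
      ((x q.1 - x q.2) * (1 + x q.2 + x q.1 * x q.2) : Laurent R) with hB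
  have hinj : Function.Injective (Equiv.swap i (i + 1)) := Equiv.injective _
  have hrA : ren (Equiv.swap i (i + 1)) hinj A = A := by
    rw [hA, map_prod]
    refine Finset.prod_congr rfl fun l hl => ?_
    simp only [Finset.mem_erase] at hl
    rw [map_mul, ren_inVar, ren_xpow, Equiv.swap_apply_of_ne_of_ne hl.2.1 hl.1]
  have hrB : ren (Equiv.swap i (i + 1)) hinj B = B := by
    rw [hB, map_prod]
    -- An adjacent transposition reverses the order of no pair other than (i, i+1).
    refine Finset.prod_equiv (Equiv.prodCongr (Equiv.swap i (i + 1)) (Equiv.swap i (i + 1)))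
      (fun q => ?_) (fun q _ => ?_)
    · obtain ⟨a, b⟩ := q
      simp only [Finset.mem_erase, Finset.mem_filter, Finset.mem_product, Finset.mem_Icc,
        Equiv.prodCongr_apply, Prod.map, Prod.mk.injEq, ne_eq, Equiv.swap_apply_def]
      split_ifs <;> omega
    · simp [ren_x]
  -- The two sides differ by the factor 1 + x_i(1 + x_{i+1}), the mirror image of the pair factor 1
  -- + x_{i+1} + x_i x_{i+1}. What remains is x_i - x_{i+1} times a symmetric series.
  have key := constantTerm_sub_mul_eq_zero (i := i) (j := i + 1)
    (S := (inVar i h * xpow i (-(n : ℤ) + 1)) * (inVar (i + 1) h * xpow (i + 1) (-(n : ℤ) + 1)) *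
      ((1 + x (i + 1) + x i * x (i + 1)) * (1 + x i + x i * x (i + 1))) * (A * B)) (by
    simp only [map_mul, map_add, map_one, ren_x, ren_inVar, ren_xpow, hrA, hrB,
      Equiv.swap_apply_left, Equiv.swap_apply_right]
    ring)
  rw [← key]
  congr 1
  ring

/-! ### Elimination of a variable by expanding the Vandermonde product -/

theorem prod_Icc_one_eq_prod_fin {M : Type*} [CommMonoid M] (n : ℕ) (f : ℕ → M) :
    ∏ i ∈ Finset.Icc 1 n, f i = ∏ i : Fin n, f (i + 1) := by
  induction n with
  | zero => simp
  | succ n ih => rw [Finset.prod_Icc_succ_top (by omega), ih, Fin.prod_univ_castSucc]; rfl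

theorem pairProduct_eq_prod_fin (n : ℕ) : pairProduct R n =
    ∏ i : Fin n, ∏ j : Fin n, if i < j then
      (x (i + 1) - x (j + 1)) * (1 + x (j + 1) + x (i + 1) * x (j + 1)) else 1 := by
  rw [pairProduct, prod_Icc_one_eq_prod_fin]
  refine Finset.prod_congr rfl fun i _ => ?_
  rw [show Finset.Ioc (i.val + 1) n = (Finset.Icc 1 n).filter (i.val + 1 < ·) by
    ext j
    simp only [Finset.mem_Icc, Finset.mem_Ioc, Finset.mem_filter]
    omega]
  rw [Finset.prod_filter, prod_Icc_one_eq_prod_fin]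
  simp

theorem prod_lt_succAbove {M : Type*} [CommMonoid M] {N : ℕ} (G : Fin (N + 1) → Fin (N + 1) → M)
    (p : Fin (N + 1)) :
    (∏ i, ∏ j, if i < j then G i j else 1) =
      (∏ i, ∏ j, if i < j then G (p.succAbove i) (p.succAbove j) else 1) *
        ∏ i, if p.succAbove i < p then G (p.succAbove i) p else G p (p.succAbove i) := by
  rw [Fin.prod_univ_succAbove _ p]
  simp_rw [Fin.prod_univ_succAbove _ p]
  rw [Finset.prod_mul_distrib]
  simp only [lt_self_iff_false, if_false, one_mul, Fin.succAbove_lt_succAbove_iff]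
  rw [← mul_assoc, mul_comm]
  congr 1
  rw [← Finset.prod_mul_distrib]
  refine Finset.prod_congr rfl fun i _ => ?_
  rcases lt_or_gt_of_ne (Fin.succAbove_ne p i) with h | h
  · simp [h, h.not_gt]
  · simp [h, h.not_gt]

/-- Laplace expansion of the Vandermonde determinant in the -v_i along the column of highest powers;
two signs (-1)^N cancel. -/
theorem prod_sub_eq_sum {S : Type*} [CommRing S] {N : ℕ} (v : Fin (N + 1) → S) :
    (∏ i, ∏ j, if i < j then v i - v j else 1) =
      ∑ p : Fin (N + 1), (-1) ^ (p : ℕ) * v p ^ N *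
        ∏ i, ∏ j, if i < j then v (p.succAbove i) - v (p.succAbove j) else 1 := by
  have key : ∀ (m : ℕ) (w : Fin m → S), (∏ i, ∏ j, if i < j then w i - w j else 1)
      = (Matrix.vandermonde fun i => -w i).det := by
    intro m w
    rw [Matrix.det_vandermonde]
    refine Finset.prod_congr rfl fun i _ => ?_
    rw [← Finset.prod_filter]
    refine Finset.prod_congr ?_ fun j _ => by ring
    ext j
    simp
  rw [key, Matrix.det_succ_column _ (Fin.last N)]
  refine Finset.sum_congr rfl fun p _ => ?_
  rw [key]
  have hm : (Matrix.vandermonde fun i => -v i).submatrix p.succAbove (Fin.last N).succAbove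
      = Matrix.vandermonde fun i => -v (p.succAbove i) := by
    ext i j
    simp [Matrix.vandermonde_apply]
  rw [hm, Matrix.vandermonde_apply, Fin.val_last, pow_add, neg_pow (v p)]
  have : ((-1 : S) ^ N) * (-1) ^ N = 1 := by
    rw [← mul_pow]
    simp
  linear_combination ((-1) ^ (p : ℕ) * v p ^ N *
    (Matrix.vandermonde fun i => -v (p.succAbove i)).det) * this

/-- Once x_p^N has cancelled x_p^{-N}, no negative power of x_p is left and x_p can be set to 0. The
pair factors that involve x_p become 1 for partners before p and 1 + x_j for partners x_j after p.
-/
theorem constantTerm_extract_term {N : ℕ} (f : ℕ → PowerSeries R) (p : Fin (N + 1)) :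
    constantTerm ((∏ i : Fin (N + 1), inVar (i + 1) (f (i + 1)) * xpow (i + 1) (-(N : ℤ))) *
      (x (p + 1) ^ N *
        (∏ i : Fin N, ∏ j : Fin N, if i < j then
          (x (p.succAbove i + 1) - x (p.succAbove j + 1) : Laurent R) else 1) *
        (∏ i : Fin (N + 1), ∏ j : Fin (N + 1), if i < j then
          (1 + x (j + 1) + x (i + 1) * x (j + 1) : Laurent R) else 1))) =
    PowerSeries.constantCoeff (f (p + 1)) *
      constantTerm ((∏ i : Fin N, inVar (p.succAbove i + 1) (f (p.succAbove i + 1)) *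
          xpow (p.succAbove i + 1) (-(N : ℤ))) *
        ((∏ i : Fin N, ∏ j : Fin N, if i < j then
          (x (p.succAbove i + 1) - x (p.succAbove j + 1) : Laurent R) else 1) *
        ((∏ i : Fin N, ∏ j : Fin N, if i < j then
          (1 + x (p.succAbove j + 1) + x (p.succAbove i + 1) * x (p.succAbove j + 1) : Laurent R)
            else 1) *
          ∏ i : Fin N, if p.succAbove i < p then 1 else 1 + x (p.succAbove i + 1)))) := by
  have hne : ∀ i : Fin N, (p.succAbove i : ℕ) + 1 ≠ p + 1 := fun i h =>
    Fin.succAbove_ne p i (Fin.ext (by omega))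
  rw [Fin.prod_univ_succAbove _ p, prod_lt_succAbove _ p, ← constantTerm_const_mul]
  set E := ∏ i : Fin N, inVar (p.succAbove i + 1) (f (p.succAbove i + 1)) *
          (xpow (p.succAbove i + 1) (-(N : ℤ)) : Laurent R) with hE
  set V := ∏ i : Fin N, ∏ j : Fin N, if i < j then
          (x (p.succAbove i + 1) - x (p.succAbove j + 1) : Laurent R) else 1 with hV
  set W := ∏ i : Fin N, ∏ j : Fin N, if i < j then
          (1 + x (p.succAbove j + 1) + x (p.succAbove i + 1) * x (p.succAbove j + 1) : Laurent R)
            else 1 with hW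
  have hEm : E ∈ nonnegIn R (p + 1) := prod_mem fun i _ =>
    mul_mem (inVar_mem_nonnegIn _ _ _) (xpow_mem_nonnegIn (hne i) _)
  have hVm : V ∈ nonnegIn R (p + 1) := by
    refine prod_mem fun i _ => prod_mem fun j _ => ?_
    split_ifs
    · exact sub_mem (x_mem_nonnegIn _ _) (x_mem_nonnegIn _ _)
    · exact one_mem _
  have hWm : W ∈ nonnegIn R (p + 1) := by
    refine prod_mem fun i _ => prod_mem fun j _ => ?_
    split_ifs
    · exact add_mem (add_mem (one_mem _) (x_mem_nonnegIn _ _))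
        (mul_mem (x_mem_nonnegIn _ _) (x_mem_nonnegIn _ _))
    · exact one_mem _
  have hx : (xpow (p + 1) (-(N : ℤ)) * x (p + 1) ^ N : Laurent R) = 1 := by
    rw [x_pow, xpow_mul_xpow, neg_add_cancel, xpow_zero]
  have hc := ((congrIn_inVar ((p : ℕ) + 1) (f (p + 1))).mul (CongrIn.refl hEm)).mul
    ((CongrIn.refl hVm).mul ((CongrIn.refl hWm).mul
      (CongrIn.prod (p := (p : ℕ) + 1) (Finset.univ : Finset (Fin N))
      (fun i => if p.succAbove i < p then
        (1 + x (p + 1) + x (p.succAbove i + 1) * x (p + 1) : Laurent R)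
        else 1 + x (p.succAbove i + 1) + x (p + 1) * x (p.succAbove i + 1))
      (fun i => if p.succAbove i < p then 1 else 1 + x (p.succAbove i + 1)) ?_)))
  · rw [mul_assoc] at hc
    rw [← mul_assoc (const _), ← hc.constantTerm_eq]
    congr 1
    linear_combination (inVar (p + 1) (f (p + 1)) * (E * V * (W *
      ∏ i : Fin N, if p.succAbove i < p then
        (1 + x (p + 1) + x (p.succAbove i + 1) * x (p + 1) : Laurent R)
        else 1 + x (p.succAbove i + 1) + x (p + 1) * x (p.succAbove i + 1)))) * hx
  · intro i _
    have h1 := one_mem (nonnegIn R (p + 1))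
    have hxi := x_mem_nonnegIn (R := R) (p + 1) (p.succAbove i + 1)
    split_ifs
    · exact CongrIn.of_eq h1 (add_mem h1 hxi) (by ring)
    · exact CongrIn.of_eq (add_mem h1 hxi) hxi (by ring)

/-- The injection `ℕ → ℕ` that leaves out the value `p`. -/
def skip (p i : ℕ) : ℕ := if i < p then i else i + 1

theorem skip_injective (p : ℕ) : Function.Injective (skip p) := by
  intro a b h
  unfold skip at h
  split_ifs at h <;> omega

theorem succAbove_val_add_one {N : ℕ} (p : Fin (N + 1)) (i : Fin N) :
    (p.succAbove i : ℕ) + 1 = skip (p + 1) (i + 1) := by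
  unfold skip Fin.succAbove
  simp only [Fin.lt_def, Fin.val_castSucc]
  split_ifs <;> first | omega | simp

theorem succAbove_lt_iff {N : ℕ} (p : Fin (N + 1)) (i : Fin N) :
    p.succAbove i < p ↔ (i : ℕ) + 1 < p + 1 := by
  unfold Fin.succAbove
  simp only [Fin.lt_def, Fin.val_castSucc]
  split_ifs <;> simp_all
  omega

/-- If all `f i` with `i ≠ p` have constant coefficient `0`, then the variable `x_p` can be
eliminated. -/
theorem pairing_extract {N p : ℕ} (hp : p ∈ Finset.Icc 1 (N + 1)) {f h : ℕ → PowerSeries R}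
    (hf : ∀ i ∈ Finset.Icc 1 (N + 1), i ≠ p → f i = PowerSeries.X * h i) :
    pairing (N + 1) f = (-1) ^ (p - 1) * PowerSeries.constantCoeff (f p) *
      pairing N fun i => if i < p then h i else (1 + PowerSeries.X) * h (i + 1) := by
  obtain ⟨p, rfl⟩ : ∃ q : Fin (N + 1), p = q + 1 := by
    rw [Finset.mem_Icc] at hp
    exact ⟨⟨p - 1, by omega⟩, by simp; omega⟩
  have hsplit : pairProduct R (N + 1) =
      (∏ i : Fin (N + 1), ∏ j : Fin (N + 1), if i < j then
        (x (i + 1) - x (j + 1) : Laurent R) else 1) *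
      ∏ i : Fin (N + 1), ∏ j : Fin (N + 1), if i < j then
        (1 + x (j + 1) + x (i + 1) * x (j + 1) : Laurent R) else 1 := by
    rw [pairProduct_eq_prod_fin, ← Finset.prod_mul_distrib]
    refine Finset.prod_congr rfl fun i _ => ?_
    rw [← Finset.prod_mul_distrib]
    refine Finset.prod_congr rfl fun j _ => ?_
    split_ifs <;> simp
  -- The factor X of each remaining series raises the exponent -N to -N + 1, as needed for N
  -- variables.
  have hvar : ∀ i : Fin N, inVar (p.succAbove i + 1) (f (p.succAbove i + 1)) *
      (xpow (p.succAbove i + 1) (-(N : ℤ)) : Laurent R) *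
      (if p.succAbove i < p then 1 else 1 + x (p.succAbove i + 1)) =
      inVar (skip (p + 1) (i + 1)) (if (i : ℕ) + 1 < p + 1 then h (i + 1)
        else (1 + PowerSeries.X) * h (i + 1 + 1)) *
      xpow (skip (p + 1) (i + 1)) (-(N : ℤ) + 1) := by
    intro i
    rw [hf]
    · simp only [succAbove_lt_iff, succAbove_val_add_one]
      rw [add_comm _ (1 : ℤ), ← xpow_mul_xpow, map_mul, inVar_X, x]
      unfold skip
      split_ifs
      · ring
      · rw [map_mul, map_add, map_one, inVar_X, x]
        ring
    · rw [Finset.mem_Icc]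
      omega
    · intro h
      exact Fin.succAbove_ne p i (Fin.ext (by omega))
  have hterm := constantTerm_extract_term (N := N) f
  rw [pairing, hsplit, prod_Icc_one_eq_prod_fin, prod_sub_eq_sum (fun i : Fin (N + 1) => x (i + 1))]
  rw [show (-((N + 1 : ℕ) : ℤ) + 1) = -(N : ℤ) by push_cast; ring]
  rw [Finset.sum_mul, Finset.mul_sum]
  have hsum : ∀ F : Fin (N + 1) → Laurent R, constantTerm (∑ q, F q) = ∑ q, constantTerm (F q) :=
    fun F => HahnSeries.coeff_sum ..
  rw [hsum, Finset.sum_eq_single p]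
  · have hneg : ((-1 : Laurent R) ^ (p : ℕ)) = const ((-1) ^ (p : ℕ)) := by
      rw [const, map_pow, map_neg, map_one]
    rw [hneg, mul_assoc (const _), mul_assoc (const _), mul_left_comm, constantTerm_const_mul, hterm,
      ← mul_assoc, Nat.add_sub_cancel]
    congr 1
    -- Renaming by `skip (p + 1)` closes the gap left by the eliminated variable.
    rw [pairing, ← constantTerm_ren (skip_injective (p + 1)) (_ * pairProduct R N), map_mul]
    congr 1
    rw [prod_Icc_one_eq_prod_fin, pairProduct_eq_prod_fin]
    simp only [map_prod, map_mul, ren_inVar, ren_xpow]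
    rw [← Finset.prod_mul_distrib.symm.trans (Finset.prod_congr rfl fun i _ => hvar i), mul_assoc]
    congr 1
    rw [← mul_assoc, mul_comm]
    congr 1
    rw [← Finset.prod_mul_distrib]
    refine Finset.prod_congr rfl fun i _ => ?_
    rw [← Finset.prod_mul_distrib]
    refine Finset.prod_congr rfl fun j _ => ?_
    simp only [succAbove_val_add_one]
    split_ifs <;> simp [ren_x]
  -- The other terms of the expansion vanish: f has constant coefficient 0 at every position but p.
  · intro q _ hq
    rw [mul_assoc (_ * _), mul_assoc (_ ^ _), mul_left_comm]
    have hneg : ((-1 : Laurent R) ^ (q : ℕ)) = const ((-1) ^ (q : ℕ)) := by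
      rw [const, map_pow, map_neg, map_one]
    rw [hneg, constantTerm_const_mul, ← mul_assoc (x _ ^ N), hterm, hf]
    · simp
    · simp only [Finset.mem_Icc]
      omega
    · intro h
      exact hq (Fin.ext (by omega))
  · simp

/-! ### Exchange and sign rules -/

open PowerSeries in
-- By linearity u((1+X)h, h) = u(h, h) + u(Xh, h), and `pairing_swap` turns u(h, h) into -u(Xh, h) -
-- u(Xh, Xh). The mixed terms cancel.
theorem pairing_exchange {n i : ℕ} (hi : 1 ≤ i) (hin : i + 1 ≤ n) (f : ℕ → PowerSeries R)
    (h : PowerSeries R) :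
    pairing n (Function.update (Function.update f i ((1 + X) * h)) (i + 1) h) =
      -pairing n (Function.update (Function.update f i (-X * h)) (i + 1) (-X * h)) := by
  have h1 : i ∈ Finset.Icc 1 n := Finset.mem_Icc.2 ⟨hi, by omega⟩
  have h2 : i + 1 ∈ Finset.Icc 1 n := Finset.mem_Icc.2 ⟨by omega, hin⟩
  set u : PowerSeries R → PowerSeries R → R := fun a b =>
    pairing n (Function.update (Function.update f i a) (i + 1) b) with hu
  have e1 : u ((1 + X) * h) h = u h h + u (X * h) h := by
    apply pairing_add h1
    · simp [add_mul]
    all_goals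
      intro l _ hl
      simp [Function.update_apply, hl]
  have e2 : u h h = u (-X * h) ((1 + X) * h) := by
    apply pairing_swap hi hin (h := h)
    all_goals simp +contextual
  have e3 : u (-X * h) ((1 + X) * h) = u (-X * h) h + u (-X * h) (X * h) := by
    apply pairing_add h2
    · simp [add_mul]
    all_goals
      intro l _ hl
      simp [hl]
  have e4 : u (-X * h) h = -1 * u (X * h) h := by
    apply pairing_smul h1
    · simp
    · intro l _ hl
      simp [Function.update_apply, hl]
  have e5 : u (-X * h) (-X * h) = -1 * u (-X * h) (X * h) := by
    apply pairing_smul h2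
    · simp
    · intro l _ hl
      simp [hl]
  change u ((1 + X) * h) h = -u (-X * h) (-X * h)
  rw [e1, e2, e3, e4, e5]
  ring

theorem pairing_neg_of_le {n K : ℕ} (hK : K ≤ n) (f : ℕ → PowerSeries R) :
    pairing n (fun i => if i ≤ K then -f i else f i) = (-1) ^ K * pairing n f := by
  induction K with
  | zero =>
    rw [pow_zero, one_mul]
    refine pairing_congr fun i hi => ?_
    rw [Finset.mem_Icc] at hi
    rw [if_neg (by omega)]
  | succ K ih =>
    rw [pow_succ', mul_assoc, ← ih (by omega)]
    apply pairing_smul (i := K + 1) (Finset.mem_Icc.2 ⟨by omega, hK⟩)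
    · simp
    · intro l _ hl
      simp only [show l ≤ K + 1 ↔ l ≤ K by omega]

/-! ### Series of single entries and their telescoping -/

/-- The power series `(1 + P X)⁻¹`. -/
def geomSeries (P : R) : PowerSeries R := PowerSeries.mk fun j => (-P) ^ j

theorem one_add_mul_geomSeries (P : R) :
    (1 + PowerSeries.C P * PowerSeries.X) * geomSeries P = 1 := by
  ext j
  rw [add_mul, one_mul, map_add, mul_assoc, PowerSeries.coeff_C_mul]
  cases j with
  | zero => simp [geomSeries]
  | succ j =>
    rw [PowerSeries.coeff_succ_X_mul, geomSeries, PowerSeries.coeff_mk, PowerSeries.coeff_mk,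
      PowerSeries.coeff_one, if_neg (by omega)]
    ring

theorem constantCoeff_geomSeries (P : R) : PowerSeries.constantCoeff (geomSeries P) = 1 := by
  simp [geomSeries]

open PowerSeries in
/-- The series that encodes the entry `a` in position `i` of the bottom row. -/
def entrySeries (P : R) (i a : ℕ) : PowerSeries R :=
  if i = 1 ∧ a = 1 then C P * geomSeries P * (1 + X) ^ 2 else (1 + X) ^ a

/-- The weight of the entry `a` in position `i` of the bottom row. -/
def entryWeight (P : R) (i a : ℕ) : R := if i = 1 ∧ a = 1 then P else 1

theorem entrySeries_of_ne {P : R} {i a : ℕ} (h : ¬(i = 1 ∧ a = 1)) :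
    entrySeries P i a = (1 + PowerSeries.X) ^ a := if_neg h

theorem entryWeight_of_ne {P : R} {i a : ℕ} (h : ¬(i = 1 ∧ a = 1)) : entryWeight P i a = 1 :=
  if_neg h

theorem constantCoeff_entrySeries (P : R) (i a : ℕ) :
    PowerSeries.constantCoeff (entrySeries P i a) = entryWeight P i a := by
  unfold entrySeries entryWeight
  split_ifs <;> simp [constantCoeff_geomSeries]

open PowerSeries in
-- Telescoping, as -X(1+X)^a = (1+X)^a - (1+X)^{a+1}.
theorem sum_neg_X_mul_pow {b c : ℕ} (h : b ≤ c) :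
    ((1 + X) ^ b : PowerSeries R) = ∑ a ∈ Finset.Icc b c, -X * (1 + X) ^ a + (1 + X) ^ (c + 1) := by
  induction c, h using Nat.le_induction with
  | base =>
    rw [Finset.Icc_self, Finset.sum_singleton]
    ring
  | succ c h ih =>
    rw [ih, Finset.sum_Icc_succ_top (by omega)]
    ring

open PowerSeries in
-- For a minimum F = `entrySeries P 1 1` this is F = P(-XF + (1+X)^2), with (1+X)^2 expanded further
-- by telescoping; otherwise it is plain telescoping.
theorem entrySeries_eq_sum (P : R) {i b c : ℕ} (hb : 1 ≤ b) (h : b ≤ c) :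
    entrySeries P i b = C (entryWeight P i b) *
      (∑ a ∈ Finset.Icc b c, -X * entrySeries P i a + (1 + X) ^ (c + 1)) := by
  by_cases h1 : i = 1 ∧ b = 1
  · obtain ⟨rfl, rfl⟩ := h1
    have hs : ∑ a ∈ Finset.Icc 1 c, -X * entrySeries P 1 a + (1 + X) ^ (c + 1) =
        -X * entrySeries P 1 1 + (1 + X) ^ 2 := by
      clear hb
      induction c, h using Nat.le_induction with
      | base => rw [Finset.Icc_self, Finset.sum_singleton]
      | succ c h ih =>
        rw [Finset.sum_Icc_succ_top (by omega), entrySeries_of_ne (by omega), ← ih]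
        ring
    rw [hs, entrySeries, if_pos ⟨rfl, rfl⟩, entryWeight, if_pos ⟨rfl, rfl⟩]
    linear_combination C P * (1 + X) ^ 2 * one_add_mul_geomSeries P
  · rw [entryWeight_of_ne h1, entrySeries_of_ne h1, map_one, one_mul, sum_neg_X_mul_pow h]
    congr 1
    refine Finset.sum_congr rfl fun a ha => ?_
    rw [Finset.mem_Icc] at ha
    rw [entrySeries_of_ne (by omega)]

/-! ### Rows interlacing with a given row -/

/-- The entries `a_j < … < a_K` with `c_i ≤ a_i ≤ c_{i+1}`, with `a_i = c_i` for all other `i`. -/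
def interlacingSet (j K : ℕ) (c : ℕ → ℕ) : Set (ℕ → ℕ) :=
  {f | (∀ i, i < j ∨ K < i → f i = c i) ∧ (∀ i, j ≤ i → i ≤ K → c i ≤ f i ∧ f i ≤ c (i + 1)) ∧
    ∀ i, j ≤ i → i < K → f i < f (i + 1)}

theorem finite_interlacingSet (j K : ℕ) (c : ℕ → ℕ) : (interlacingSet j K c).Finite := by
  have hinj : Function.Injective (fun (f : interlacingSet j K c) (i : Finset.Icc j K) =>
      (⟨f.1 i, by
        have hi := Finset.mem_Icc.1 i.2
        have h1 := (f.2.2.1 i hi.1 hi.2).2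
        have h2 := Finset.single_le_sum (f := fun i => c (i + 1)) (fun _ _ => Nat.zero_le _) i.2
        omega⟩ : Fin (∑ i ∈ Finset.Icc j K, c (i + 1) + 1))) := by
    intro f g h
    ext i
    by_cases hi : i ∈ Finset.Icc j K
    · exact congrArg Fin.val (congrFun h ⟨i, hi⟩)
    · rw [Finset.mem_Icc] at hi
      rw [f.2.1 i (by omega), g.2.1 i (by omega)]
  exact Set.finite_coe_iff.1 (Finite.of_injective _ hinj)

/-- The finset version of `interlacingSet`. -/
def interlacing (j K : ℕ) (c : ℕ → ℕ) : Finset (ℕ → ℕ) := (finite_interlacingSet j K c).toFinset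

theorem mem_interlacing {j K : ℕ} {c f : ℕ → ℕ} : f ∈ interlacing j K c ↔
    (∀ i, i < j ∨ K < i → f i = c i) ∧ (∀ i, j ≤ i → i ≤ K → c i ≤ f i ∧ f i ≤ c (i + 1)) ∧
      ∀ i, j ≤ i → i < K → f i < f (i + 1) :=
  Set.Finite.mem_toFinset _

theorem interlacing_of_lt {j K : ℕ} (h : K < j) (c : ℕ → ℕ) : interlacing j K c = {c} := by
  ext f
  rw [mem_interlacing, Finset.mem_singleton]
  constructor
  · intro hf
    ext i
    exact hf.1 i (by omega)
  · rintro rfl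
    exact ⟨fun _ _ => rfl, fun i _ _ => by omega, fun i _ _ => by omega⟩

theorem mem_interlacing_update_succ {j K a : ℕ} (hj : j ≤ K) {c f : ℕ → ℕ} :
    f ∈ interlacing (j + 1) K (Function.update c j a) ↔
      f j = a ∧ (∀ i, i < j ∨ K < i → f i = c i) ∧
        (∀ i, j + 1 ≤ i → i ≤ K → c i ≤ f i ∧ f i ≤ c (i + 1)) ∧
        ∀ i, j + 1 ≤ i → i < K → f i < f (i + 1) := by
  rw [mem_interlacing]
  constructor
  · rintro ⟨h1, h2, h3⟩
    refine ⟨by simpa using h1 j (by omega), fun i hi => ?_, fun i hi hi' => ?_, h3⟩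
    · have := h1 i (by omega)
      rwa [Function.update_of_ne (by omega)] at this
    · have := h2 i hi hi'
      rwa [Function.update_of_ne (by omega), Function.update_of_ne (by omega)] at this
  · rintro ⟨h0, h1, h2, h3⟩
    refine ⟨fun i hi => ?_, fun i hi hi' => ?_, h3⟩
    · by_cases h : i = j
      · rw [h, h0, Function.update_self]
      · rw [Function.update_of_ne h, h1 i (by omega)]
    · rw [Function.update_of_ne (by omega), Function.update_of_ne (by omega)]
      exact h2 i hi hi'

theorem mem_interlacing_update_add_two {j K a : ℕ} (hj : j < K) {c f : ℕ → ℕ} :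
    f ∈ interlacing (j + 2) K (Function.update c j a) ↔
      f j = a ∧ f (j + 1) = c (j + 1) ∧ (∀ i, i < j ∨ K < i → f i = c i) ∧
        (∀ i, j + 2 ≤ i → i ≤ K → c i ≤ f i ∧ f i ≤ c (i + 1)) ∧
        ∀ i, j + 2 ≤ i → i < K → f i < f (i + 1) := by
  rw [mem_interlacing]
  constructor
  · rintro ⟨h1, h2, h3⟩
    refine ⟨by simpa using h1 j (by omega), by simpa using h1 (j + 1) (by omega), fun i hi => ?_,
      fun i hi hi' => ?_, h3⟩
    · have := h1 i (by omega)
      rwa [Function.update_of_ne (by omega)] at this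
    · have := h2 i hi hi'
      rwa [Function.update_of_ne (by omega), Function.update_of_ne (by omega)] at this
  · rintro ⟨h0, h0', h1, h2, h3⟩
    refine ⟨fun i hi => ?_, fun i hi hi' => ?_, h3⟩
    · by_cases h : i = j
      · rw [h, h0, Function.update_self]
      · rw [Function.update_of_ne h]
        by_cases h' : i = j + 1
        · rw [h', h0']
        · exact h1 i (by omega)
    · rw [Function.update_of_ne (by omega), Function.update_of_ne (by omega)]
      exact h2 i hi hi'

open scoped Classical in
theorem sum_sum_interlacing (j K : ℕ) (hj : j ≤ K) (c : ℕ → ℕ) (E : (ℕ → ℕ) → R) :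
    ∑ a ∈ Finset.Icc (c j) (c (j + 1)), ∑ f ∈ interlacing (j + 1) K (Function.update c j a), E f =
      ∑ f ∈ (Finset.Icc (c j) (c (j + 1))).biUnion
        fun a => interlacing (j + 1) K (Function.update c j a), E f := by
  rw [Finset.sum_biUnion]
  intro a _ b _ hab
  rw [Function.onFun, Finset.disjoint_left]
  intro f hf hf'
  rw [mem_interlacing_update_succ hj] at hf hf'
  exact hab (hf.1.symm.trans hf'.1)

theorem sum_interlacing_last {K : ℕ} (c : ℕ → ℕ) (E : (ℕ → ℕ) → R) :
    ∑ a ∈ Finset.Icc (c K) (c (K + 1)), E (Function.update c K a) =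
      ∑ f ∈ interlacing K K c, E f := by
  classical
  have h : ∀ a, E (Function.update c K a) =
      ∑ f ∈ interlacing (K + 1) K (Function.update c K a), E f := fun a => by
    rw [interlacing_of_lt (by omega), Finset.sum_singleton]
  rw [Finset.sum_congr rfl fun a _ => h a, sum_sum_interlacing K K le_rfl]
  refine Finset.sum_congr ?_ fun _ _ => rfl
  ext f
  simp only [Finset.mem_biUnion, mem_interlacing_update_succ le_rfl, Finset.mem_Icc,
    mem_interlacing]
  constructor
  · rintro ⟨a, ha, rfl, h1, -, -⟩
    refine ⟨h1, fun i hi hi' => ?_, fun i _ _ => by omega⟩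
    obtain rfl : i = K := by omega
    exact ha
  · rintro ⟨h1, h2, -⟩
    exact ⟨f K, h2 K le_rfl le_rfl, rfl, h1, fun i _ _ => by omega, fun i _ _ => by omega⟩

/-- On the left f_j ≤ c_{j+1} ≤ f_{j+1}, so strictness between positions j and j+1 fails only if
both entries equal c_{j+1}. The second sum on the right collects these rows. -/
theorem sum_interlacing_step {j K : ℕ} (hj : j < K) (c : ℕ → ℕ)
    (hc : ∀ i, j ≤ i → i ≤ K → c i < c (i + 1)) (E : (ℕ → ℕ) → R) :
    ∑ a ∈ Finset.Icc (c j) (c (j + 1)), ∑ f ∈ interlacing (j + 1) K (Function.update c j a), E f =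
      ∑ f ∈ interlacing j K c, E f +
        ∑ f ∈ interlacing (j + 2) K (Function.update c j (c (j + 1))), E f := by
  classical
  rw [sum_sum_interlacing j K hj.le, ← Finset.sum_union]
  · refine Finset.sum_congr ?_ fun _ _ => rfl
    ext f
    simp only [Finset.mem_biUnion, mem_interlacing_update_succ hj.le, Finset.mem_Icc,
      Finset.mem_union, mem_interlacing_update_add_two hj]
    rw [mem_interlacing]
    constructor
    · rintro ⟨a, ha, rfl, h1, h2, h3⟩
      have h4 := h2 (j + 1) le_rfl hj
      by_cases h : f j < f (j + 1)
      · refine Or.inl ⟨h1, fun i hi hi' => ?_, fun i hi hi' => ?_⟩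
        · by_cases hij : i = j
          · rwa [hij]
          · exact h2 i (by omega) hi'
        · by_cases hij : i = j
          · rwa [hij]
          · exact h3 i (by omega) hi'
      · exact Or.inr ⟨by omega, by omega, h1, fun i hi => h2 i (by omega),
          fun i hi => h3 i (by omega)⟩
    · rintro (⟨h1, h2, h3⟩ | ⟨h0, h0', h1, h2, h3⟩)
      · exact ⟨f j, h2 j le_rfl hj.le, rfl, h1, fun i hi => h2 i (by omega),
          fun i hi => h3 i (by omega)⟩
      · refine ⟨f j, ?_, rfl, h1, fun i hi hi' => ?_, fun i hi hi' => ?_⟩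
        · have := hc j le_rfl hj.le
          omega
        · by_cases hij : i = j + 1
          · have := hc (j + 1) (by omega) (by omega)
            rw [hij]
            omega
          · exact h2 i (by omega) hi'
        · by_cases hij : i = j + 1
          · subst hij
            have h5 := h2 (j + 2) (by omega) (by omega)
            have := hc (j + 1) (by omega) (by omega)
            rw [h0']
            exact this.trans_le h5.1
          · exact h3 i (by omega) hi'
  · rw [Finset.disjoint_left]
    intro f hf hf'
    rw [mem_interlacing] at hf
    rw [mem_interlacing_update_add_two hj] at hf'
    have := hf.2.2 j le_rfl hj
    omega

/-- Summation over interlacing rows, one entry at a time. -/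
theorem eq_sum_interlacing (P : R) {K t : ℕ} (hK : 1 ≤ K) (Ψ : ℕ → (ℕ → ℕ) → R)
    (hstep : ∀ j c, 1 ≤ j → j < K → (∀ i, j ≤ i → i ≤ K → c i < c (i + 1)) → 1 ≤ c j →
      c (K + 1) = t →
      Ψ j c = entryWeight P j (c j) *
        (∑ a ∈ Finset.Icc (c j) (c (j + 1)), Ψ (j + 1) (Function.update c j a) -
          Ψ (j + 2) (Function.update c j (c (j + 1)))))
    (hlast : ∀ c, c K < c (K + 1) → 1 ≤ c K → c (K + 1) = t →
      Ψ K c = entryWeight P K (c K) *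
        ∑ a ∈ Finset.Icc (c K) (c (K + 1)), Ψ (K + 1) (Function.update c K a))
    (d j : ℕ) (c : ℕ → ℕ) (hd : j + d = K + 1) (hj : 1 ≤ j)
    (hc : ∀ i, j ≤ i → i ≤ K → c i < c (i + 1)) (hcj : 1 ≤ c j) (hct : c (K + 1) = t) :
    Ψ j c = entryWeight P j (c j) * ∑ f ∈ interlacing j K c, Ψ (K + 1) f := by
  induction d using Nat.strong_induction_on generalizing j c with
  | _ d ih =>
    match d, ih with
    | 0, _ =>
      obtain rfl : j = K + 1 := by omega
      rw [interlacing_of_lt (by omega), Finset.sum_singleton, entryWeight_of_ne (by omega), one_mul]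
    | 1, _ =>
      obtain rfl : j = K := by omega
      rw [hlast c (hc j le_rfl le_rfl) hcj hct, sum_interlacing_last]
    | d + 2, ih =>
      have h1 := hc j le_rfl (by omega)
      have h2 := hc (j + 1) (by omega) (by omega)
      have hu : ∀ a, ∀ i, j + 1 ≤ i → i ≤ K →
          Function.update c j a i < Function.update c j a (i + 1) := by
        intro a i hi hi'
        rw [Function.update_of_ne (by omega), Function.update_of_ne (by omega)]
        exact hc i (by omega) hi'
      rw [hstep j c hj (by omega) hc hcj hct]
      congr 1
      -- The term subtracted in `hstep` is the surplus of `sum_interlacing_step`. Beyond position 1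
      -- all weights are 1.
      rw [ih d (by omega) (j + 2) _ (by omega) (by omega) (fun i hi => hu _ i (by omega))
        (by rw [Function.update_of_ne (by omega)]; change 1 ≤ c (j + 1 + 1); omega)
        (by rwa [Function.update_of_ne (by omega)]), entryWeight_of_ne (by omega), one_mul, sub_eq_iff_eq_add,
        ← sum_interlacing_step (by omega) c hc]
      refine Finset.sum_congr rfl fun a _ => ?_
      rw [ih (d + 1) (by omega) (j + 1) _ (by omega) (by omega) (hu a)
        (by rw [Function.update_of_ne (by omega)]; omega)
        (by rwa [Function.update_of_ne (by omega)]), entryWeight_of_ne (by omega), one_mul]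

open PowerSeries

/-! ### The row recursion for the pairing -/

/-- The series for a row `c` of `K` entries, followed by the series `X⁻¹ (1 + X) h i`. -/
def reducedSeries (P : R) (K : ℕ) (h : ℕ → PowerSeries R) (c : ℕ → ℕ) (i : ℕ) : PowerSeries R :=
  if i ≤ K then entrySeries P i (c i) else (1 + X) * h (i + 1)

/-- The sign (-1)^K of `pairing_extract` at position K+1 cancels against the minus signs of the K
factors -X. -/
theorem pairing_eq_reduced {N K : ℕ} (hK : K ≤ N) {P : R} {f h : ℕ → PowerSeries R} {c : ℕ → ℕ}
    (hf : ∀ i ∈ Finset.Icc 1 K, f i = -X * entrySeries P i (c i))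
    (hf' : ∀ i ∈ Finset.Icc (K + 2) (N + 1), f i = X * h i) :
    pairing (N + 1) f = constantCoeff (f (K + 1)) * pairing N (reducedSeries P K h c) := by
  have h1 := pairing_extract (N := N) (p := K + 1) (f := f)
    (h := fun i => if i ≤ K then -entrySeries P i (c i) else h i)
    (Finset.mem_Icc.2 ⟨by omega, by omega⟩) (fun i hi hiK => by
      rw [Finset.mem_Icc] at hi
      by_cases hle : i ≤ K
      · rw [if_pos hle, hf i (Finset.mem_Icc.2 ⟨hi.1, hle⟩)]
        ring
      · rw [if_neg hle, hf' i (Finset.mem_Icc.2 ⟨by omega, hi.2⟩)])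
  have h2 := pairing_neg_of_le hK (reducedSeries P K h c)
  rw [h1, Nat.add_sub_cancel]
  have h3 : (pairing N fun i => if i < K + 1 then
      (fun i => if i ≤ K then -entrySeries P i (c i) else h i) i
      else (1 + X) * (fun i => if i ≤ K then -entrySeries P i (c i) else h i) (i + 1)) =
      pairing N fun i => if i ≤ K then -reducedSeries P K h c i else reducedSeries P K h c i := by
    refine pairing_congr fun i _ => ?_
    by_cases hi : i ≤ K
    · simp [reducedSeries, hi, Nat.lt_succ_of_le hi]
    · simp [reducedSeries, hi, show ¬ i < K + 1 by omega, show ¬ i + 1 ≤ K by omega]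
  rw [h3, h2]
  have h4 : ((-1 : R) ^ K) * (-1) ^ K = 1 := by
    rw [← mul_pow]
    simp
  linear_combination constantCoeff (f (K + 1)) * pairing N (reducedSeries P K h c) * h4

theorem pairing_eq_zero {N : ℕ} {f h : ℕ → PowerSeries R}
    (hf : ∀ i ∈ Finset.Icc 1 (N + 1), f i = X * h i) : pairing (N + 1) f = 0 := by
  have h1 : (1 : ℕ) ∈ Finset.Icc 1 (N + 1) := Finset.mem_Icc.2 ⟨le_rfl, by omega⟩
  rw [pairing_extract h1 fun i hi _ => hf i hi, hf 1 h1]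
  simp

/-- The series for a row `c` whose first `j - 1` entries have been summed over. -/
def mixedSeries (P : R) (K : ℕ) (h : ℕ → PowerSeries R) (j : ℕ) (c : ℕ → ℕ) (i : ℕ) :
    PowerSeries R :=
  if i < j then -X * entrySeries P i (c i) else if i ≤ K then entrySeries P i (c i) else h i

theorem update_mixedSeries (P : R) {K j : ℕ} (hj : j ≤ K) (h : ℕ → PowerSeries R) (c : ℕ → ℕ)
    (a : ℕ) : Function.update (mixedSeries P K h j c) j (-X * entrySeries P j a) =
      mixedSeries P K h (j + 1) (Function.update c j a) := by
  ext1 i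
  unfold mixedSeries
  by_cases hi : i = j
  · subst hi
    simp
  · rw [Function.update_of_ne hi, Function.update_of_ne hi]
    simp only [show i < j + 1 ↔ i < j by omega]

/-- One entry of the bottom row is expanded into a sum over the entry above it. -/
theorem pairing_mixedSeries_eq_sum (P : R) {n K j : ℕ} (hj : 1 ≤ j) (hjK : j ≤ K) (hK : K ≤ n)
    (h : ℕ → PowerSeries R) (c : ℕ → ℕ) (hc : 1 ≤ c j) {t : ℕ} (ht : c j ≤ t) :
    pairing n (mixedSeries P K h j c) = entryWeight P j (c j) *
      (∑ a ∈ Finset.Icc (c j) t, pairing n (mixedSeries P K h (j + 1) (Function.update c j a)) +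
        pairing n (Function.update (mixedSeries P K h j c) j ((1 + X) ^ (t + 1)))) := by
  have hjn : j ∈ Finset.Icc 1 n := Finset.mem_Icc.2 ⟨hj, by omega⟩
  rw [pairing_smul hjn (entryWeight P j (c j)) (g := Function.update (mixedSeries P K h j c) j
    (∑ a ∈ Finset.Icc (c j) t, -X * entrySeries P j a + (1 + X) ^ (t + 1)))]
  · congr 1
    rw [pairing_add hjn (g := Function.update (mixedSeries P K h j c) j
        (∑ a ∈ Finset.Icc (c j) t, -X * entrySeries P j a))
      (h := Function.update (mixedSeries P K h j c) j ((1 + X) ^ (t + 1))), pairing_sum hjn]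
    · congr 1
      refine Finset.sum_congr rfl fun a _ => ?_
      rw [update_mixedSeries P hjK]
    · simp
    · intro l _ hl
      simp [hl]
    · intro l _ hl
      simp [hl]
  · rw [Function.update_self, ← entrySeries_eq_sum P hc ht, mixedSeries, if_neg (lt_irrefl j),
      if_pos hjK]
  · intro l _ hl
    simp [hl]

/-- With upper limit c_{j+1}, the remainder and its neighbour are (1+X)h and h for h =
(1+X)^{c_{j+1}}, so `pairing_exchange` applies. -/
theorem pairing_mixedSeries_step (P : R) {n K j : ℕ} (hj : 1 ≤ j) (hjK : j < K) (hK : K ≤ n)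
    (h : ℕ → PowerSeries R) (c : ℕ → ℕ) (hc : 1 ≤ c j) (hcj : c j < c (j + 1)) :
    pairing n (mixedSeries P K h j c) = entryWeight P j (c j) *
      (∑ a ∈ Finset.Icc (c j) (c (j + 1)),
          pairing n (mixedSeries P K h (j + 1) (Function.update c j a)) -
        pairing n (mixedSeries P K h (j + 2) (Function.update c j (c (j + 1))))) := by
  rw [pairing_mixedSeries_eq_sum P hj hjK.le hK h c hc hcj.le, sub_eq_add_neg]
  congr 2
  have e1 : Function.update (mixedSeries P K h j c) j ((1 + X) ^ (c (j + 1) + 1)) =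
      Function.update (Function.update (mixedSeries P K h j c) j ((1 + X) * (1 + X) ^ c (j + 1)))
        (j + 1) ((1 + X) ^ c (j + 1)) := by
    rw [← pow_succ']
    symm
    rw [Function.update_eq_self_iff, Function.update_of_ne (by omega), mixedSeries,
      if_neg (by omega), if_pos (by omega), entrySeries_of_ne (by omega)]
  have e2 : Function.update (Function.update (mixedSeries P K h j c) j (-X * (1 + X) ^ c (j + 1)))
        (j + 1) (-X * (1 + X) ^ c (j + 1)) =
      mixedSeries P K h (j + 2) (Function.update c j (c (j + 1))) := by
    -- Since c_{j+1} > c_j ≥ 1, this entry is no minimum, and its series is a plain power even in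
    -- position 1.
    have h1 : ((1 + X) ^ c (j + 1) : PowerSeries R) = entrySeries P j (c (j + 1)) :=
      (entrySeries_of_ne (by omega)).symm
    have h2 : ((1 + X) ^ c (j + 1) : PowerSeries R) = entrySeries P (j + 1) (c (j + 1)) :=
      (entrySeries_of_ne (by omega)).symm
    nth_rewrite 2 [h2]
    rw [h1, update_mixedSeries P hjK.le, update_mixedSeries P hjK]
    congr 1
    rw [Function.update_eq_self_iff, Function.update_of_ne (by omega)]
  rw [e1, pairing_exchange hj (by omega), e2]

/-- Telescoping stops at t, and the remainder supplies the term t+1. Its weight q comes from the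
splitting (1+qX)(1+X)^t = q(1+X)^{t+1} + (1-q)(1+X)^t. -/
theorem pairing_mixedSeries_last (P q : R) {N K t : ℕ} (hK : 1 ≤ K) (hKN : K ≤ N)
    (h : ℕ → PowerSeries R) (hh : h (K + 1) = (1 + C q * X) * (1 + X) ^ t)
    (h' : ℕ → PowerSeries R) (hh' : ∀ i ∈ Finset.Icc (K + 2) (N + 1), h i = X * h' i)
    (c : ℕ → ℕ) (hc : 1 ≤ c K) (hct : c K < t + 1) :
    pairing (N + 1) (mixedSeries P K h K c) = entryWeight P K (c K) *
      ∑ a ∈ Finset.Icc (c K) (t + 1), (if a = t + 1 then q else 1) *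
        pairing N (reducedSeries P K h' (Function.update c K a)) := by
  rw [pairing_mixedSeries_eq_sum P hK le_rfl (by omega) h c hc (Nat.le_of_lt_succ hct),
    Finset.sum_Icc_succ_top (by omega), if_pos rfl]
  congr 2
  · refine Finset.sum_congr rfl fun a ha => ?_
    rw [Finset.mem_Icc] at ha
    rw [if_neg (by omega), one_mul, pairing_eq_reduced hKN (P := P) (h := h') (c := Function.update c K a)]
    · rw [mixedSeries, if_neg (by omega), if_neg (by omega), hh]
      simp
    · intro i hi
      rw [Finset.mem_Icc] at hi
      rw [mixedSeries, if_pos (by omega)]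
    · intro i hi
      have hi' := Finset.mem_Icc.1 hi
      rw [mixedSeries, if_neg (by omega), if_neg (by omega), hh' i hi]
  · have hK1 : K + 1 ∈ Finset.Icc 1 (N + 1) := Finset.mem_Icc.2 ⟨by omega, by omega⟩
    set f := mixedSeries P K h K c with hf
    have hfK : ∀ i ∈ Finset.Icc 1 (N + 1), i ≠ K → i ≠ K + 1 →
        f i = X * if i < K then -entrySeries P i (c i) else h' i := by
      intro i hi h1 h2
      rw [Finset.mem_Icc] at hi
      rw [hf, mixedSeries]
      by_cases hiK : i < K
      · rw [if_pos hiK, if_pos hiK]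
        ring
      · rw [if_neg hiK, if_neg hiK, if_neg (by omega), hh' i (Finset.mem_Icc.2 ⟨by omega, by omega⟩)]
    set u : PowerSeries R → PowerSeries R → R := fun a b =>
      pairing (N + 1) (Function.update (Function.update f K a) (K + 1) b) with hu
    have e0 : Function.update f K ((1 + X) ^ (t + 1)) = Function.update
        (Function.update f K ((1 + X) ^ (t + 1))) (K + 1) ((1 + C q * X) * (1 + X) ^ t) := by
      symm
      rw [Function.update_eq_self_iff, Function.update_of_ne (by omega), hf, mixedSeries,
        if_neg (by omega), if_neg (by omega), hh]
    rw [e0]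
    change u ((1 + X) ^ (t + 1)) ((1 + C q * X) * (1 + X) ^ t) = _
    have e1 : u ((1 + X) ^ (t + 1)) ((1 + C q * X) * (1 + X) ^ t) =
        u ((1 + X) ^ (t + 1)) (C q * (1 + X) ^ (t + 1)) +
          u ((1 + X) ^ (t + 1)) (C (1 - q) * (1 + X) ^ t) := by
      apply pairing_add hK1
      · simp only [Function.update_self, map_sub, map_one]
        ring
      all_goals
        intro l _ hl
        simp [hl]
    have e2 : ∀ a b r, u a (C r * b) = r * u a b := by
      intro a b r
      apply pairing_smul hK1
      · simp
      · intro l _ hl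
        simp [hl]
    -- After the exchange every series is divisible by X.
    have e3 : u ((1 + X) ^ (t + 1)) ((1 + X) ^ t) = 0 := by
      rw [pow_succ']
      change pairing _ _ = _
      rw [pairing_exchange hK (by omega), neg_eq_zero]
      apply pairing_eq_zero (h := fun i => if i = K ∨ i = K + 1 then -(1 + X) ^ t else
        if i < K then -entrySeries P i (c i) else h' i)
      intro i hi
      by_cases h1 : i = K + 1
      · subst h1
        simp
      · by_cases h2 : i = K
        · subst h2
          simp
        · rw [Function.update_of_ne h1, Function.update_of_ne h2, hfK i hi h2 h1]
          simp only [h1, h2, or_self, if_false]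
    have e4 : u ((1 + X) ^ (t + 1)) ((1 + X) ^ (t + 1)) =
        u (-X * (1 + X) ^ (t + 1)) ((1 + X) * (1 + X) ^ (t + 1)) := by
      apply pairing_swap hK (by omega) (h := (1 + X) ^ (t + 1))
      all_goals simp +contextual
    have e5 : u (-X * (1 + X) ^ (t + 1)) ((1 + X) * (1 + X) ^ (t + 1)) =
        pairing N (reducedSeries P K h' (Function.update c K (t + 1))) := by
      change pairing _ _ = _
      rw [pairing_eq_reduced hKN (P := P) (h := h') (c := Function.update c K (t + 1))]
      · simp
      · intro i hi
        rw [Finset.mem_Icc] at hi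
        rw [Function.update_of_ne (by omega)]
        by_cases h2 : i = K
        · subst h2
          rw [Function.update_self, Function.update_self, entrySeries_of_ne (by omega)]
        · rw [Function.update_of_ne h2, Function.update_of_ne h2, hf, mixedSeries,
            if_pos (by omega)]
      · intro i hi
        have hi' := Finset.mem_Icc.1 hi
        rw [Function.update_of_ne (by omega), Function.update_of_ne (by omega), hf, mixedSeries,
          if_neg (by omega), if_neg (by omega), hh' i hi]
    rw [e1, e2, e2, e3, e4, e5]
    ring

/-- The recursion that removes the bottom row. -/
theorem pairing_eq_sum_interlacing (P q : R) {N K t : ℕ} (hK : 1 ≤ K) (hKN : K ≤ N)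
    (h : ℕ → PowerSeries R) (hh : h (K + 1) = (1 + C q * X) * (1 + X) ^ t)
    (h' : ℕ → PowerSeries R) (hh' : ∀ i ∈ Finset.Icc (K + 2) (N + 1), h i = X * h' i)
    (c : ℕ → ℕ) (hc : ∀ i, 1 ≤ i → i ≤ K → c i < c (i + 1)) (hc1 : 1 ≤ c 1)
    (hct : c (K + 1) = t + 1) :
    pairing (N + 1) (fun i => if i ≤ K then entrySeries P i (c i) else h i) =
      entryWeight P 1 (c 1) * ∑ f ∈ interlacing 1 K c, (if f K = t + 1 then q else 1) *
        pairing N (reducedSeries P K h' f) := by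
  -- At stage K+1 all entries of the new row are chosen and one variable has been eliminated.
  set Ψ : ℕ → (ℕ → ℕ) → R := fun j c => if j ≤ K then pairing (N + 1) (mixedSeries P K h j c)
    else (if c K = t + 1 then q else 1) * pairing N (reducedSeries P K h' c) with hΨ
  have key := eq_sum_interlacing P (t := t + 1) hK Ψ ?_ ?_ K 1 c (by omega) le_rfl hc hc1 hct
  · simp only [hΨ, if_pos hK, if_neg (show ¬ K + 1 ≤ K by omega)] at key
    rw [← key]
    refine pairing_congr fun i hi => ?_
    rw [Finset.mem_Icc] at hi
    rw [mixedSeries, if_neg (show ¬ i < 1 by omega)]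
  · intro j c hj hjK hc hcj hct
    have h1 := hc j le_rfl hjK.le
    simp only [hΨ, if_pos hjK.le, if_pos (show j + 1 ≤ K from hjK)]
    rw [pairing_mixedSeries_step P hj hjK (by omega) h c hcj h1]
    congr 2
    split_ifs with h2 h3
    · rfl
    · obtain rfl : K = j + 1 := by omega
      have := hc (j + 1) (by omega) le_rfl
      rw [Function.update_of_ne (by omega)] at h3
      omega
    -- Both new entries equal c_K < t+1, so there is no factor q, and x_{K+1} is eliminated
    -- directly.
    · obtain rfl : K = j + 1 := by omega
      rw [one_mul, pairing_eq_reduced hKN (P := P) (h := h')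
        (c := Function.update c j (c (j + 1)))]
      · rw [mixedSeries, if_neg (by omega), if_neg (by omega), hh]
        simp
      · intro i hi
        rw [Finset.mem_Icc] at hi
        rw [mixedSeries, if_pos (by omega)]
      · intro i hi
        have hi' := Finset.mem_Icc.1 hi
        rw [mixedSeries, if_neg (by omega), if_neg (by omega), hh' i hi]
  · intro c hc hcK hct
    simp only [hΨ, if_pos le_rfl, if_neg (show ¬ K + 1 ≤ K by omega)]
    rw [pairing_mixedSeries_last P q hK hKN h hh h' hh' c hcK (by omega), hct]
    simp

/-! ### Removing the bottom row of a trapezoid -/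

theorem mem_shape {n k i j : ℕ} : (i, j) ∈ shape n k ↔ 1 ≤ i ∧ i ≤ n ∧ 1 ≤ j ∧ j ≤ k ∧ j ≤ i := by
  simp only [shape, Finset.mem_filter, Finset.mem_product, Finset.mem_Icc]
  tauto

theorem bound_succ {m N i j : ℕ} (hi : i ≤ N) : bound (m + 1) N i j = bound m (N + 1) i j := by
  unfold bound
  omega

namespace Trapezoid

variable {m N k : ℕ}

/-- The trapezoid without its bottom row. -/
def truncate (M : Trapezoid m (N + 1) k) : Trapezoid (m + 1) N k where
  entry i j := if i ≤ N then M.entry i j else 0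
  entry_outside i j h := by
    split_ifs with hi
    · exact M.entry_outside i j (by rw [mem_shape] at *; omega)
    · rfl
  entry_pos i j h := by
    rw [mem_shape] at h
    rw [if_pos h.2.1]
    exact M.entry_pos i j (by rw [mem_shape]; omega)
  entry_le i j h := by
    rw [mem_shape] at h
    rw [if_pos h.2.1, bound_succ h.2.1]
    exact M.entry_le i j (by rw [mem_shape]; omega)
  northEast i j h h' := by
    rw [mem_shape] at h h'
    rw [if_pos h.2.1, if_pos h'.2.1]
    exact M.northEast i j (by rw [mem_shape]; omega) (by rw [mem_shape]; omega)
  southEast i j h h' := by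
    rw [mem_shape] at h h'
    rw [if_pos h.2.1, if_pos h'.2.1]
    exact M.southEast i j (by rw [mem_shape]; omega) (by rw [mem_shape]; omega)
  row_strict i j h h' := by
    rw [mem_shape] at h h'
    rw [if_pos h.2.1, if_pos h'.2.1]
    exact M.row_strict i j (by rw [mem_shape]; omega) (by rw [mem_shape]; omega)

theorem truncate_entry (M : Trapezoid m (N + 1) k) {i : ℕ} (hi : i ≤ N) (j : ℕ) :
    M.truncate.entry i j = M.entry i j := if_pos hi

/-- The trapezoid `M` with the additional bottom row `b`. -/
def extend (M : Trapezoid (m + 1) N k) (b : ℕ → ℕ)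
    (hb : ∀ j, 1 ≤ j → j ≤ min (N + 1) k → 1 ≤ b j ∧ b j ≤ m + j)
    (hlt : ∀ j, 1 ≤ j → j < min (N + 1) k → b j < b (j + 1))
    (hle : ∀ j, 1 ≤ j → j ≤ min N k → b j ≤ M.entry N j)
    (hge : ∀ j, 1 ≤ j → j ≤ min N k → j < k → M.entry N j ≤ b (j + 1)) :
    Trapezoid m (N + 1) k where
  entry i j := if i = N + 1 then (if 1 ≤ j ∧ j ≤ min (N + 1) k then b j else 0) else M.entry i j
  entry_outside i j h := by
    rw [mem_shape] at h
    split_ifs with hi hj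
    · omega
    · rfl
    · exact M.entry_outside i j (by rw [mem_shape]; omega)
  entry_pos i j h := by
    rw [mem_shape] at h
    split_ifs with hi hj
    · exact (hb j hj.1 hj.2).1
    · omega
    · exact M.entry_pos i j (by rw [mem_shape]; omega)
  entry_le i j h := by
    rw [mem_shape] at h
    split_ifs with hi hj
    · have := (hb j hj.1 hj.2).2
      unfold bound
      omega
    · omega
    · rw [← bound_succ (by omega)]
      exact M.entry_le i j (by rw [mem_shape]; omega)
  northEast i j h h' := by
    rw [mem_shape] at h h'
    rw [if_neg (show ¬ i = N + 1 by omega)]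
    by_cases hi : i = N
    · subst hi
      rw [if_pos rfl, if_pos (by omega)]
      exact hle j (by omega) (by omega)
    · rw [if_neg (by omega)]
      exact M.northEast i j (by rw [mem_shape]; omega) (by rw [mem_shape]; omega)
  southEast i j h h' := by
    rw [mem_shape] at h h'
    rw [if_neg (show ¬ i = N + 1 by omega)]
    by_cases hi : i = N
    · subst hi
      rw [if_pos rfl, if_pos (by omega)]
      exact hge j (by omega) (by omega) (by omega)
    · rw [if_neg (by omega)]
      exact M.southEast i j (by rw [mem_shape]; omega) (by rw [mem_shape]; omega)
  row_strict i j h h' := by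
    rw [mem_shape] at h h'
    by_cases hi : i = N + 1
    · rw [if_pos hi, if_pos hi, if_pos (by omega), if_pos (by omega)]
      exact hlt j (by omega) (by omega)
    · rw [if_neg hi, if_neg hi]
      exact M.row_strict i j (by rw [mem_shape]; omega) (by rw [mem_shape]; omega)

/-- Rows increase strictly and are positive, so only the first entry of the bottom row can be a
minimum. -/
theorem numMinima_truncate (M : Trapezoid m (N + 1) k) :
    M.numMinima = M.truncate.numMinima + if 1 ≤ k ∧ M.entry (N + 1) 1 = 1 then 1 else 0 := by
  have h1 : ((shape (N + 1) k).filter fun p => M.entry p.1 p.2 = 1) =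
      ((shape N k).filter fun p => M.truncate.entry p.1 p.2 = 1) ∪
        if 1 ≤ k ∧ M.entry (N + 1) 1 = 1 then {(N + 1, 1)} else ∅ := by
    ext ⟨i, j⟩
    rw [Finset.mem_union, Finset.mem_filter, Finset.mem_filter, mem_shape, mem_shape]
    by_cases hi : i ≤ N
    · rw [truncate_entry M hi]
      split_ifs
      · simp only [Finset.mem_singleton, Prod.mk.injEq]
        omega
      · simp only [Finset.notMem_empty, or_false]
        omega
    · have h2 : i = N + 1 → 1 ≤ j → j ≤ k → j ≤ i → M.entry i j = 1 → j = 1 := by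
        rintro rfl h1 h2 h3 h4
        by_contra h5
        have h6 := M.row_strict (N + 1) (j - 1) (by rw [mem_shape]; omega)
          (by rw [mem_shape]; omega)
        have h7 := M.entry_pos (N + 1) (j - 1) (by rw [mem_shape]; omega)
        rw [Nat.sub_add_cancel h1] at h6
        omega
      split_ifs with h
      · simp only [Finset.mem_singleton, Prod.mk.injEq]
        constructor
        · rintro ⟨h3, h4⟩
          have := h2 (by omega) (by omega) (by omega) (by omega) h4
          omega
        · rintro (h3 | ⟨rfl, rfl⟩)
          · omega
          · exact ⟨by omega, h.2⟩
      · simp only [Finset.notMem_empty, or_false]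
        constructor
        · rintro ⟨h3, h4⟩
          obtain rfl := h2 (by omega) (by omega) (by omega) (by omega) h4
          obtain rfl : i = N + 1 := by omega
          exact absurd ⟨by omega, h4⟩ h
        · intro h3
          omega
  unfold numMinima
  rw [h1, Finset.card_union_of_disjoint]
  · split_ifs <;> simp
  · rw [Finset.disjoint_left]
    rintro ⟨i, j⟩ h3 h4
    rw [Finset.mem_filter, mem_shape] at h3
    split_ifs at h4
    · simp only [Finset.mem_singleton, Prod.mk.injEq] at h4
      omega
    · simp at h4

/-- The uncounted corner moves from (N+1, k) to (N, k), so a maximum at (N, k) has to be added back.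
-/
theorem numMaxima'_truncate (M : Trapezoid m (N + 1) k) :
    M.numMaxima' = M.truncate.numMaxima' +
      if 1 ≤ k ∧ k ≤ N ∧ M.entry N k = m + k + 1 then 1 else 0 := by
  have h1 : M.maxima.erase (N + 1, k) = M.truncate.maxima := by
    ext ⟨i, j⟩
    simp only [maxima, Finset.mem_erase, Finset.mem_filter, mem_shape, ne_eq, Prod.mk.injEq]
    by_cases hi : i ≤ N
    · rw [truncate_entry M hi, bound_succ hi]
      constructor
      · rintro ⟨-, h1, h2⟩
        exact ⟨by omega, h2⟩
      · rintro ⟨h1, h2⟩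
        exact ⟨by omega, by omega, h2⟩
    · constructor
      · rintro ⟨h1, h2, h3⟩
        omega
      · rintro ⟨h1, h2⟩
        omega
  have h2 : (N, k) ∈ M.truncate.maxima ↔ 1 ≤ k ∧ k ≤ N ∧ M.entry N k = m + k + 1 := by
    simp only [maxima, Finset.mem_filter, mem_shape]
    rw [truncate_entry M le_rfl, bound, true_and]
    omega
  unfold numMaxima'
  rw [h1]
  split_ifs with h
  · rw [Finset.card_erase_add_one (h2.2 h)]
  · rw [Finset.erase_eq_of_notMem (mt h2.1 h), add_zero]

end Trapezoid

/-! ### The generating function and its recursion -/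

open scoped Classical in
/-- The generating function of the trapezoids with bottom row `b`. -/
def genSum (P Q : R) (m n k : ℕ) (b : ℕ → ℕ) : R :=
  -- The recursion also reaches n < k, where the bottom row has only n entries.
  ∑ M : Trapezoid m n k with ∀ j ∈ Finset.Icc 1 (min n k), M.entry n j = b j,
    P ^ M.numMinima * Q ^ M.numMaxima'

/-- The row `b` of `k` entries, followed by the value `m + k + 1`. -/
def cappedRow (m k : ℕ) (b : ℕ → ℕ) (i : ℕ) : ℕ := if i ≤ k then b i else m + k + 1

/-- A trapezoid corresponds to its truncation together with the row above `b`. The value m+k+1 in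
`cappedRow` is the bound for the k-th entry of that row, so the bound becomes part of the
interlacing condition. -/
theorem genSum_succ (P Q : R) (m N k : ℕ) (b : ℕ → ℕ)
    (hb : ∀ j, 1 ≤ j → j ≤ min (N + 1) k → 1 ≤ b j ∧ b j ≤ m + j)
    (hlt : ∀ j, 1 ≤ j → j < min (N + 1) k → b j < b (j + 1)) :
    genSum P Q m (N + 1) k b = (if 1 ≤ k then entryWeight P 1 (b 1) else 1) *
      ∑ f ∈ interlacing 1 (min N k) (cappedRow m k b),
        (if 1 ≤ k ∧ k ≤ N ∧ f k = m + k + 1 then Q else 1) * genSum P Q (m + 1) N k f := by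
  classical
  unfold genSum
  simp_rw [Finset.mul_sum]
  rw [Finset.sum_sigma']
  refine Finset.sum_bij (fun M _ => ⟨fun i => if 1 ≤ i ∧ i ≤ min N k then M.entry N i
    else cappedRow m k b i, M.truncate⟩) ?_ ?_ ?_ ?_
  · intro M hM
    simp only [Finset.mem_filter, Finset.mem_univ, true_and, Finset.mem_Icc] at hM
    simp only [Finset.mem_sigma, Finset.mem_filter, Finset.mem_univ, true_and, mem_interlacing]
    refine ⟨⟨fun i hi => ?_, fun i hi hi' => ⟨?_, ?_⟩, fun i hi hi' => ?_⟩, fun i hi => ?_⟩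
    · rw [if_neg (by omega)]
    · rw [if_pos ⟨hi, hi'⟩, cappedRow, if_pos (by omega), ← hM i (by omega)]
      exact M.northEast N i (by rw [mem_shape]; omega) (by rw [mem_shape]; omega)
    · rw [if_pos ⟨hi, hi'⟩, cappedRow]
      split_ifs with h
      · rw [← hM (i + 1) (by omega)]
        exact M.southEast N i (by rw [mem_shape]; omega) (by rw [mem_shape]; omega)
      · have h1 := M.entry_le N i (by rw [mem_shape]; omega)
        unfold bound at h1
        omega
    · rw [if_pos (by omega), if_pos (by omega)]
      exact M.row_strict N i (by rw [mem_shape]; omega) (by rw [mem_shape]; omega)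
    · rw [Finset.mem_Icc] at hi
      rw [if_pos hi, M.truncate_entry le_rfl]
  · intro M hM M' hM' h
    simp only [Finset.mem_filter, Finset.mem_univ, true_and, Finset.mem_Icc] at hM hM'
    rw [Sigma.mk.injEq, heq_eq_eq] at h
    ext i j
    by_cases hi : i ≤ N
    · rw [← M.truncate_entry hi, h.2, M'.truncate_entry hi]
    · by_cases hs : (i, j) ∈ shape (N + 1) k
      · rw [mem_shape] at hs
        obtain rfl : i = N + 1 := by omega
        rw [hM j (by omega), hM' j (by omega)]
      · rw [M.entry_outside i j hs, M'.entry_outside i j hs]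
  · rintro ⟨f, M⟩ h
    simp only [Finset.mem_sigma, Finset.mem_filter, Finset.mem_univ, true_and, mem_interlacing,
      Finset.mem_Icc] at h
    obtain ⟨⟨h1, h2, -⟩, h4⟩ := h
    refine ⟨M.extend b hb hlt (fun j hj hj' => ?_) (fun j hj hj' hjk => ?_), ?_, ?_⟩
    · have := (h2 j hj hj').1
      rwa [cappedRow, if_pos (by omega), ← h4 j ⟨hj, hj'⟩] at this
    · have := (h2 j hj hj').2
      rwa [cappedRow, if_pos (by omega), ← h4 j ⟨hj, hj'⟩] at this
    · simp only [Finset.mem_filter, Finset.mem_univ, true_and, Finset.mem_Icc]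
      intro j hj
      simp only [Trapezoid.extend, if_true, if_pos hj]
    · rw [Sigma.mk.injEq, heq_eq_eq]
      constructor
      · ext i
        split_ifs with hi
        · rw [← h4 i hi]
          exact if_neg (by omega)
        · rw [h1 i (by omega)]
      · ext i j
        by_cases hi : i ≤ N
        · rw [Trapezoid.truncate_entry _ hi]
          exact if_neg (by omega)
        · rw [M.entry_outside i j (by rw [mem_shape]; omega)]
          exact if_neg hi
  · intro M hM
    simp only [Finset.mem_filter, Finset.mem_univ, true_and, Finset.mem_Icc] at hM
    rw [M.numMinima_truncate, M.numMaxima'_truncate, pow_add, pow_add]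
    have e1 : (P ^ (if 1 ≤ k ∧ M.entry (N + 1) 1 = 1 then 1 else 0) : R) =
        if 1 ≤ k then entryWeight P 1 (b 1) else 1 := by
      unfold entryWeight
      by_cases hk : 1 ≤ k
      · rw [hM 1 (by omega)]
        split_ifs <;> simp_all
      · simp [hk]
    have e2 : (Q ^ (if 1 ≤ k ∧ k ≤ N ∧ M.entry N k = m + k + 1 then 1 else 0) : R) =
        if 1 ≤ k ∧ k ≤ N ∧ (if 1 ≤ k ∧ k ≤ min N k then M.entry N k
          else cappedRow m k b k) = m + k + 1 then Q else 1 := by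
      by_cases hk : 1 ≤ k ∧ k ≤ N
      · rw [if_pos (show 1 ≤ k ∧ k ≤ min N k by omega)]
        split_ifs <;> simp
      · rw [if_neg (by tauto), if_neg (by tauto), pow_zero]
    rw [e1, e2]
    ring

/-- The series in the constant term formula. -/
def rowSeries (P Q : R) (m k : ℕ) (b : ℕ → ℕ) (i : ℕ) : PowerSeries R :=
  if i ≤ k then entrySeries P i (b i)
  else X ^ (i - k - 1) * (1 + C Q * X) * (1 + X) ^ (m + k)

theorem genSum_eq_pairing (P Q : R) (n m k : ℕ) (b : ℕ → ℕ)
    (hb : ∀ j, 1 ≤ j → j ≤ min n k → 1 ≤ b j ∧ b j ≤ m + j)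
    (hlt : ∀ j, 1 ≤ j → j < min n k → b j < b (j + 1)) :
    genSum P Q m n k b = pairing n (rowSeries P Q m k b) := by
  induction n generalizing m b with
  | zero =>
    have hs : shape 0 k = ∅ := by
      ext ⟨i, j⟩
      rw [mem_shape]
      simp
      omega
    have hu : ∀ M M' : Trapezoid m 0 k, M = M' := by
      intro M M'
      ext i j
      rw [M.entry_outside i j (by simp [hs]), M'.entry_outside i j (by simp [hs])]
    let M₀ : Trapezoid m 0 k := ⟨fun _ _ => 0, fun _ _ _ => rfl, by simp [hs], by simp [hs],
      by simp [hs], by simp [hs], by simp [hs]⟩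
    rw [pairing_zero, genSum, Finset.sum_eq_single M₀]
    · simp [Trapezoid.numMinima, Trapezoid.numMaxima', Trapezoid.maxima, hs]
    · intro M _ hM
      exact absurd (hu M M₀) hM
    · intro h
      simp at h
  | succ N ih =>
    -- Multiplied by 1+X and moved down one position, these are the series for m+1.
    set h' : ℕ → PowerSeries R := fun i =>
      X ^ (i - k - 2) * (1 + C Q * X) * (1 + X) ^ (m + k) with hh'
    set K := min N k with hK
    have hcap : ∀ i, 1 ≤ i → i ≤ K → cappedRow m k b i < cappedRow m k b (i + 1) := by
      intro i hi hi'
      rw [cappedRow, cappedRow, if_pos (by omega)]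
      split_ifs with h
      · exact hlt i hi (by omega)
      · have := hb i hi (by omega)
        have : i = k := by omega
        omega
    have hred : ∀ f, pairing N (reducedSeries P K h' f) = pairing N (rowSeries P Q (m + 1) k f) := by
      intro f
      refine pairing_congr fun i hi => ?_
      rw [Finset.mem_Icc] at hi
      unfold reducedSeries rowSeries
      by_cases hik : i ≤ k
      · rw [if_pos (by omega), if_pos hik]
      · rw [if_neg (by omega), if_neg hik, hh']
        simp only [show i + 1 - k - 2 = i - k - 1 by omega, show m + 1 + k = m + k + 1 by ring]
        ring
    have hrest : ∀ i ∈ Finset.Icc (K + 2) (N + 1), rowSeries P Q m k b i = X * h' i := by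
      intro i hi
      rw [Finset.mem_Icc] at hi
      rw [rowSeries, if_neg (by omega), hh']
      simp only [show i - k - 1 = i - k - 2 + 1 by omega]
      ring
    have hih : ∀ f ∈ interlacing 1 K (cappedRow m k b),
        genSum P Q (m + 1) N k f = pairing N (reducedSeries P K h' f) := by
      intro f hf
      rw [mem_interlacing] at hf
      rw [hred]
      refine ih (m + 1) f (fun j hj hj' => ?_) hf.2.2
      have h1 := hf.2.1 j hj hj'
      have h2 := hb j hj (by omega)
      unfold cappedRow at h1
      rw [if_pos (by omega)] at h1
      split_ifs at h1 with h
      · have := hb (j + 1) (by omega) (by omega)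
        omega
      · omega
    rw [genSum_succ P Q m N k b hb hlt, ← hK, Finset.sum_congr rfl fun f hf => by rw [hih f hf]]
    -- Here k = 0 or N = 0: there is no entry above, and one variable is eliminated at once.
    by_cases hK0 : K = 0
    · rw [hK0, interlacing_of_lt (by omega), Finset.sum_singleton,
        if_neg (show ¬(1 ≤ k ∧ k ≤ N ∧ _) by omega), one_mul,
        pairing_eq_reduced (K := 0) (P := P) (h := h') (c := cappedRow m k b) (by omega)
          (by simp) (by rwa [hK0] at hrest), rowSeries]
      congr 1
      by_cases hk : 1 ≤ k
      · rw [if_pos hk, if_pos (by omega), constantCoeff_entrySeries, zero_add]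
      · rw [if_neg hk, if_neg (show ¬ 0 + 1 ≤ k by omega)]
        simp [show k = 0 by omega]
    · rw [if_pos (by omega)]
      have hw1 : cappedRow m k b 1 = b 1 := if_pos (by omega)
      have hleft : pairing (N + 1) (rowSeries P Q m k b) = pairing (N + 1) (fun i => if i ≤ K then
          entrySeries P i (cappedRow m k b i) else rowSeries P Q m k b i) := by
        refine pairing_congr fun i _ => ?_
        by_cases hi : i ≤ K
        · rw [if_pos hi, rowSeries, if_pos (by omega), cappedRow, if_pos (by omega)]
        · rw [if_neg hi]
      by_cases hkN : k ≤ N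
      · have hKk : K = k := by omega
        rw [hleft, pairing_eq_sum_interlacing P Q (t := m + k) (by omega) (by omega) _ ?_ h' hrest
          _ hcap ?_ ?_, hw1]
        · congr 1
          refine Finset.sum_congr rfl fun f _ => ?_
          rw [hKk]
          congr 1
          refine if_congr ?_ rfl rfl
          omega
        · rw [rowSeries, if_neg (by omega), show K + 1 - k - 1 = 0 by omega, pow_zero, one_mul]
        · rw [hw1]
          exact (hb 1 le_rfl (by omega)).1
        · rw [cappedRow, if_neg (by omega)]
      -- The bottom row has N+1 entries, and the last one takes the role of the cap: (1+X)^{b_{N+1}}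
      -- = (1+qX)(1+X)^t with q = 1 and t + 1 = b_{N+1}.
      · have h3 := hb (K + 1) (by omega) (by omega)
        rw [hleft, pairing_eq_sum_interlacing P 1 (t := b (K + 1) - 1) (by omega) (by omega) _ ?_ h'
          hrest _ hcap ?_ ?_, hw1]
        · congr 1
          refine Finset.sum_congr rfl fun f _ => ?_
          rw [if_neg (by omega), ite_self]
        · rw [rowSeries, if_pos (by omega), entrySeries_of_ne (by omega), map_one, one_mul,
            ← pow_succ', Nat.sub_add_cancel h3.1]
        · rw [hw1]
          exact (hb 1 le_rfl (by omega)).1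
        · rw [cappedRow, if_pos (by omega), Nat.sub_add_cancel h3.1]

/-! ### Comparison with the integrands -/

open PowerSeries in
theorem inVar_one_add_C_mul_X (i : ℕ) (c : R) :
    inVar i (1 + C c * X) = 1 + const c * x i := by
  rw [map_add, map_one, map_mul, inVar_C, inVar_X]

open PowerSeries in
theorem inVar_one_add_X_pow (i a : ℕ) :
    inVar i ((1 + X) ^ a : PowerSeries R) = (1 + x i) ^ a := by
  rw [map_pow, map_add, map_one, inVar_X]

theorem inVar_geomSeries (P : R) (i : ℕ) :
    inVar i (geomSeries P) = Ring.inverse (1 + const P * x i) := by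
  have h : inVar i (1 + PowerSeries.C P * PowerSeries.X) * inVar i (geomSeries P) = 1 := by
    rw [← map_mul, one_add_mul_geomSeries, map_one]
  rw [inVar_one_add_C_mul_X] at h
  have h' := Ring.inverse_mul_cancel_left (1 + const P * x i) (inVar i (geomSeries P))
    (isUnit_one_add P i)
  rw [← h', h, mul_one]

theorem pairing_rowSeries (P Q : R) {m n k : ℕ} (hk : k ≤ n) (b : ℕ → ℕ) :
    pairing n (rowSeries P Q m k b) = constantTerm
      ((∏ i ∈ Finset.Icc 1 k, inVar i (entrySeries P i (b i)) * xpow i (-(n : ℤ) + 1))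
        * maximaProduct m n k Q * pairProduct R n) := by
  rw [pairing]
  congr 2
  have hunion : Finset.Icc 1 n = Finset.Icc 1 k ∪ Finset.Icc (k + 1) n := by
    ext i
    simp only [Finset.mem_union, Finset.mem_Icc]
    omega
  rw [hunion, Finset.prod_union]
  · congr 1
    · refine Finset.prod_congr rfl fun i hi => ?_
      rw [Finset.mem_Icc] at hi
      rw [rowSeries, if_pos hi.2]
    · refine Finset.prod_congr rfl fun i hi => ?_
      rw [Finset.mem_Icc] at hi
      rw [rowSeries, if_neg (by omega), map_mul, map_mul, inVar_one_add_C_mul_X,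
        inVar_one_add_X_pow, map_pow, inVar_X, x_pow]
      rw [show -(n : ℤ) + i - k = ((i - k - 1 : ℕ) : ℤ) + (-(n : ℤ) + 1) by omega,
        ← xpow_mul_xpow i _ (-(n : ℤ) + 1)]
      ring
  · rw [Finset.disjoint_left]
    intro i hi hi'
    rw [Finset.mem_Icc] at hi hi'
    omega

theorem constantTerm_minMaxIntegrand (P Q : R) {m n k : ℕ} (hk1 : 1 ≤ k) (hk : k ≤ n) {b : ℕ → ℕ}
    (hb : b 1 = 1) :
    constantTerm (minMaxIntegrand m n k b P Q) = pairing n (rowSeries P Q m k b) := by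
  rw [pairing_rowSeries P Q hk, minMaxIntegrand]
  congr 3
  rw [← Finset.mul_prod_erase _ _ (Finset.mem_Icc.2 ⟨le_rfl, hk1⟩)]
  congr 1
  · rw [entrySeries, if_pos ⟨rfl, hb⟩, map_mul, map_mul, inVar_C, inVar_geomSeries,
      inVar_one_add_X_pow]
  · refine Finset.prod_congr ?_ fun i hi => ?_
    · ext i
      simp only [Finset.mem_erase, Finset.mem_Icc]
      omega
    · simp only [Finset.mem_erase, Finset.mem_Icc] at hi
      rw [entrySeries_of_ne (by omega), inVar_one_add_X_pow]

/-- (1+X)^{-1}(1+X)^2 = 1+X, so for P = 1 minima need no separate treatment. -/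
theorem entrySeries_one (i a : ℕ) : entrySeries (1 : R) i a = (1 + PowerSeries.X) ^ a := by
  unfold entrySeries
  split_ifs with h
  · have := one_add_mul_geomSeries (1 : R)
    rw [map_one, one_mul] at this
    rw [h.2, map_one]
    linear_combination (1 + PowerSeries.X) * this
  · rfl

theorem constantTerm_maxIntegrand (Q : R) {m n k : ℕ} (hk : k ≤ n) (b : ℕ → ℕ) :
    constantTerm (maxIntegrand m n k b Q) = pairing n (rowSeries 1 Q m k b) := by
  rw [pairing_rowSeries 1 Q hk, maxIntegrand]
  simp only [entrySeries_one, inVar_one_add_X_pow]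

open scoped Classical in
theorem sum_hasBottomRow (P Q : R) {m n k : ℕ} (hk : k ≤ n) {b : ℕ → ℕ} (hb : IsBottomRow m k b) :
    ∑ M : Trapezoid m n k with M.HasBottomRow b, P ^ M.numMinima * Q ^ M.numMaxima' =
      pairing n (rowSeries P Q m k b) := by
  rw [← genSum_eq_pairing P Q n m k b]
  · unfold genSum Trapezoid.HasBottomRow
    rw [min_eq_right hk]
  · intro j hj hj'
    exact hb.2 j (Finset.mem_Icc.2 ⟨hj, by omega⟩)
  · intro j hj hj'
    exact hb.1 ⟨hj, by omega⟩ ⟨by omega, by omega⟩ (Nat.lt_succ_self j)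

/-! ### The forced bottom row for m = 0 -/

theorem isBottomRow_id (k : ℕ) : IsBottomRow 0 k fun j => j := by
  refine ⟨fun _ _ _ _ h => h, fun j hj => ?_⟩
  rw [Finset.mem_Icc] at hj
  exact ⟨hj.1, (Nat.zero_add j).ge⟩

/-- Strict increase from at least 1 gives m_{n,j} ≥ j, and j is also the upper bound. -/
theorem Trapezoid.hasBottomRow_id {n k : ℕ} (hk : k ≤ n) (M : Trapezoid 0 n k) :
    M.HasBottomRow fun j => j := by
  have h : ∀ j, j + 1 ≤ k → j + 1 ≤ M.entry n (j + 1) := by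
    intro j hj
    induction j with
    | zero => exact M.entry_pos n 1 (by rw [mem_shape]; omega)
    | succ j ih =>
      have := ih (by omega)
      have := M.row_strict n (j + 1) (by rw [mem_shape]; omega) (by rw [mem_shape]; omega)
      omega
  intro j hj
  rw [Finset.mem_Icc] at hj
  obtain ⟨j, rfl⟩ := Nat.exists_eq_add_of_le' hj.1
  have h1 := h j hj.2
  have h2 := M.entry_le n (j + 1) (by rw [mem_shape]; omega)
  unfold bound at h2
  change M.entry n (j + 1) = j + 1
  omega

/-- The entry m_{n,k} = k attains its bound, so it is always a maximum; this is the extra factor Q.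
-/
theorem Trapezoid.numMaxima_eq {n k : ℕ} (hk1 : 1 ≤ k) (hk : k ≤ n) (M : Trapezoid 0 n k) :
    M.numMaxima = M.numMaxima' + 1 := by
  have h := M.hasBottomRow_id hk k (Finset.mem_Icc.2 ⟨hk1, le_rfl⟩)
  rw [numMaxima, numMaxima', Finset.card_erase_add_one]
  rw [maxima, Finset.mem_filter, mem_shape, bound]
  dsimp only at h ⊢
  omega

end Gog

end

open Classical in
theorem mainTheorem7 {R : Type*} [CommRing R] (P Q : R) (n k : ℕ) (hk : k ≤ n) :
    (∀ (m : ℕ) (b : ℕ → ℕ), 1 ≤ k → Gog.IsBottomRow m k b → b 1 = 1 →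
      ∑ M : Gog.Trapezoid m n k with M.HasBottomRow b, P ^ M.numMinima * Q ^ M.numMaxima'
        = Gog.constantTerm (Gog.minMaxIntegrand m n k b P Q)) ∧
    (∀ (m : ℕ) (b : ℕ → ℕ), Gog.IsBottomRow m k b →
      ∑ M : Gog.Trapezoid m n k with M.HasBottomRow b, Q ^ M.numMaxima'
        = Gog.constantTerm (Gog.maxIntegrand m n k b Q)) ∧
    (1 ≤ k →
      ∑ M : Gog.Trapezoid 0 n k, P ^ M.numMinima * Q ^ M.numMaxima
        = Gog.constantTerm
            (Gog.const (P * Q) * Ring.inverse (1 + Gog.const P * Gog.x 1) * (1 + Gog.x 1) ^ 2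
              * Gog.xpow 1 (-(n : ℤ) + 1)
              * (∏ i ∈ Finset.Icc 2 k, (1 + Gog.x i) ^ i * Gog.xpow i (-(n : ℤ) + 1))
              * Gog.maximaProduct 0 n k Q * Gog.pairProduct R n)) := by
  refine ⟨fun m b hk1 hb hb1 => ?_, fun m b hb => ?_, fun hk1 => ?_⟩
  · rw [Gog.constantTerm_minMaxIntegrand P Q hk1 hk hb1, ← Gog.sum_hasBottomRow P Q hk hb]
  · rw [Gog.constantTerm_maxIntegrand Q hk, ← Gog.sum_hasBottomRow 1 Q hk hb]
    simp only [one_pow, one_mul]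
  · have h : Gog.const (P * Q) * Ring.inverse (1 + Gog.const P * Gog.x 1) * (1 + Gog.x 1) ^ 2
        * Gog.xpow 1 (-(n : ℤ) + 1)
        * (∏ i ∈ Finset.Icc 2 k, (1 + Gog.x i) ^ i * Gog.xpow i (-(n : ℤ) + 1))
        * Gog.maximaProduct 0 n k Q * Gog.pairProduct R n
        = Gog.const Q * Gog.minMaxIntegrand 0 n k (fun j => j) P Q := by
      rw [Gog.minMaxIntegrand, show Gog.const (P * Q) = Gog.const P * Gog.const Q from map_mul _ P Q]
      ring
    rw [h, Gog.constantTerm_const_mul, Gog.constantTerm_minMaxIntegrand P Q hk1 hk rfl,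
      ← Gog.sum_hasBottomRow P Q hk (Gog.isBottomRow_id k), Finset.mul_sum,
      Finset.filter_true_of_mem fun M _ => M.hasBottomRow_id hk]
    refine Finset.sum_congr rfl fun M _ => ?_
    rw [M.numMaxima_eq hk1 hk]
    ring
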